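/- Let $S$ be a finite set with more than one element, let $G$ be the free group on $S$, and let $\lambda$ be the left regular representation of $G$ on $\ell^2(G)$. Let $\eta$ be a unitary representation of $G$ on a complex Hilbert space $H$ which is tempered, i.e. weakly contained in $\lambda$: $\|\eta(f)\| \le \|\lambda(f)\|$ for every $f$ in the group algebra $\mathbb{C}[G]$. Assume that for every irreducible finite-dimensional unitary representation $\pi$ of $G$ the tensor product $\eta\otimes\pi$ is irreducible (a unitary representation is irreducible if its space is nonzero and has no closed invariant subspaces other than $0$ and the whole space). Let $M$ be an infinite-dimensional separable complex Hilbert space. Identify the unitary representations $\pi$ of $G$ on $M$ with the tuples $(\pi(s))_{s\in S}$ of unitary operators on $M$, and give the set of these tuples the product of the strong operator topologies. Then the set of those $\pi$ for which $\eta\otimes\pi$, acting on the Hilbert space tensor product $H\otimes M$, is irreducible is comeagre (its complement is of first category), and it is of second category (not meagre). -/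

import Mathlib

open scoped TensorProduct

universe u v w

/-- A unitary representation of the discrete group `G` on `H`: a homomorphism from `G` to the group
of unitary operators (surjective linear isometries) of `H`. -/
abbrev UnitaryRep (G : Type u) [Group G] (H : Type v) [NormedAddCommGroup H]
    [InnerProductSpace ℂ H] : Type (max u v) :=
  G →* (H ≃ₗᵢ[ℂ] H)

namespace UnitaryRep

section Basic

variable {G : Type u} [Group G] {H : Type v} [NormedAddCommGroup H] [InnerProductSpace ℂ H]

/-- Topological irreducibility: the space is nonzero and the only closed invariant subspaces are
the trivial ones. -/
def IsIrreducible (π : UnitaryRep G H) : Prop :=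
  Nontrivial H ∧ ∀ K : Submodule ℂ H, IsClosed (K : Set H) →
    (∀ g : G, ∀ x ∈ K, π g x ∈ K) → K = ⊥ ∨ K = ⊤

/-- The bounded operator `π g`, multiplicatively in `g`. -/
noncomputable def toOperators (π : UnitaryRep G H) : G →* (H →L[ℂ] H) where
  toFun g := (π g).toContinuousLinearEquiv.toContinuousLinearMap
  map_one' := by ext x; simp
  map_mul' g h := by ext x; simp

/-- The extension of a unitary representation to the group algebra `ℂ[G]`, so that
`π(f) = ∑ g, f g • π g`. -/
noncomputable def groupAlgebra (π : UnitaryRep G H) : MonoidAlgebra ℂ G →ₐ[ℂ] (H →L[ℂ] H) :=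
  MonoidAlgebra.lift ℂ (H →L[ℂ] H) G π.toOperators

end Basic

section Regular

variable {G : Type u} [Group G]

theorem memLp_leftTranslate (g : G) (f : lp (fun _ : G => ℂ) 2) :
    Memℓp (fun x : G => f (g⁻¹ * x)) 2 := by
  have h2 : (0 : ℝ) < (2 : ENNReal).toReal := by norm_num
  rw [memℓp_gen_iff h2]
  exact (Equiv.mulLeft g⁻¹).summable_iff.mpr ((memℓp_gen_iff h2).mp (lp.memℓp f))

/-- Left translation `f ↦ f (g⁻¹ * ·)` on `ℓ²(G)`. -/
noncomputable def leftTranslate (g : G) : lp (fun _ : G => ℂ) 2 →ₗᵢ[ℂ] lp (fun _ : G => ℂ) 2 where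
  toFun f := ⟨fun x => f (g⁻¹ * x), memLp_leftTranslate g f⟩
  map_add' _ _ := rfl
  map_smul' _ _ := rfl
  norm_map' f := by
    have h2 : (0 : ℝ) < (2 : ENNReal).toReal := by norm_num
    rw [lp.norm_eq_tsum_rpow h2, lp.norm_eq_tsum_rpow h2]
    congr 1
    exact (Equiv.mulLeft g⁻¹).tsum_eq (fun x => ‖f x‖ ^ (2 : ENNReal).toReal)

theorem leftTranslate_apply (g : G) (f : lp (fun _ : G => ℂ) 2) (x : G) :
    leftTranslate g f x = f (g⁻¹ * x) := rfl

/-- The left regular representation of `G` on `ℓ²(G)`. -/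
noncomputable def regular (G : Type u) [Group G] : UnitaryRep G (lp (fun _ : G => ℂ) 2) where
  toFun g :=
    { (leftTranslate g).toLinearMap with
      invFun := leftTranslate g⁻¹
      left_inv := fun f => by
        apply Subtype.ext; funext x
        change f (g⁻¹ * (g⁻¹⁻¹ * x)) = f x
        simp
      right_inv := fun f => by
        apply Subtype.ext; funext x
        change f (g⁻¹⁻¹ * (g⁻¹ * x)) = f x
        simp
      norm_map' := (leftTranslate g).norm_map }
  map_one' := by
    ext f x
    change f (1⁻¹ * x) = f x
    simp
  map_mul' g h := by
    ext f x
    change f ((g * h)⁻¹ * x) = f (h⁻¹ * (g⁻¹ * x))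
    simp [mul_assoc]

end Regular

section Tempered

variable {G : Type u} [Group G] {H : Type v} [NormedAddCommGroup H] [InnerProductSpace ℂ H]

/-- `η` is weakly contained in `σ`: the operator norms satisfy `‖η(f)‖ ≤ ‖σ(f)‖` for all `f` in
the group algebra. -/
def WeaklyContained {K : Type w} [NormedAddCommGroup K] [InnerProductSpace ℂ K]
    (η : UnitaryRep G H) (σ : UnitaryRep G K) : Prop :=
  ∀ f : MonoidAlgebra ℂ G, ‖η.groupAlgebra f‖ ≤ ‖σ.groupAlgebra f‖

/-- `η` is tempered: it is weakly contained in the regular representation. -/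
def IsTempered (η : UnitaryRep G H) : Prop :=
  η.WeaklyContained (regular G)

end Tempered

end UnitaryRep

section HilbertTensor

variable {H : Type v} [NormedAddCommGroup H] [InnerProductSpace ℂ H]
  {M : Type w} [NormedAddCommGroup M] [InnerProductSpace ℂ M]

/-- The tensor product of Hilbert spaces: the completion of the algebraic tensor product for
`⟪x ⊗ y, x' ⊗ y'⟫ = ⟪x, x'⟫ * ⟪y, y'⟫`. -/
abbrev HilbertTensor (H : Type v) [NormedAddCommGroup H] [InnerProductSpace ℂ H]
    (M : Type w) [NormedAddCommGroup M] [InnerProductSpace ℂ M] : Type (max v w) :=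
  UniformSpace.Completion (H ⊗[ℂ] M)

namespace HilbertTensor

/-- The operator `a ⊗ b` on `H ⊗ M`, for unitary `a` and `b`: the continuous extension of
`x ⊗ y ↦ a x ⊗ b y`. -/
noncomputable def mapCLM (a : H ≃ₗᵢ[ℂ] H) (b : M ≃ₗᵢ[ℂ] M) :
    HilbertTensor H M →L[ℂ] HilbertTensor H M :=
  (TensorProduct.congrIsometry a b).toContinuousLinearEquiv.toContinuousLinearMap.completion

theorem mapCLM_coe (a : H ≃ₗᵢ[ℂ] H) (b : M ≃ₗᵢ[ℂ] M) (z : H ⊗[ℂ] M) :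
    mapCLM a b (z : HilbertTensor H M) =
      ((TensorProduct.congrIsometry a b z : H ⊗[ℂ] M) : HilbertTensor H M) :=
  ContinuousLinearMap.completion_apply_coe _ z

theorem mapCLM_tmul (a : H ≃ₗᵢ[ℂ] H) (b : M ≃ₗᵢ[ℂ] M) (x : H) (y : M) :
    mapCLM a b ((x ⊗ₜ[ℂ] y : H ⊗[ℂ] M) : HilbertTensor H M) =
      ((a x ⊗ₜ[ℂ] b y : H ⊗[ℂ] M) : HilbertTensor H M) :=
  mapCLM_coe a b _

theorem mapCLM_one_one (z : HilbertTensor H M) :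
    mapCLM (1 : H ≃ₗᵢ[ℂ] H) (1 : M ≃ₗᵢ[ℂ] M) z = z := by
  induction z using UniformSpace.Completion.induction_on with
  | hp => exact isClosed_eq (ContinuousLinearMap.continuous _) continuous_id
  | ih z =>
    rw [mapCLM_coe]
    congr 1
    induction z using TensorProduct.induction_on with
    | zero => simp
    | tmul x y => rfl
    | add x y hx hy => rw [map_add, hx, hy]

theorem mapCLM_mul (a a' : H ≃ₗᵢ[ℂ] H) (b b' : M ≃ₗᵢ[ℂ] M) (z : HilbertTensor H M) :
    mapCLM (a * a') (b * b') z = mapCLM a b (mapCLM a' b' z) := by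
  induction z using UniformSpace.Completion.induction_on with
  | hp =>
    exact isClosed_eq (ContinuousLinearMap.continuous _)
      ((ContinuousLinearMap.continuous _).comp (ContinuousLinearMap.continuous _))
  | ih z =>
    rw [mapCLM_coe, mapCLM_coe, mapCLM_coe]
    congr 1
    induction z using TensorProduct.induction_on with
    | zero => simp
    | tmul x y => rfl
    | add x y hx hy => rw [map_add, map_add, map_add, hx, hy]

theorem norm_mapCLM (a : H ≃ₗᵢ[ℂ] H) (b : M ≃ₗᵢ[ℂ] M) (z : HilbertTensor H M) :
    ‖mapCLM a b z‖ = ‖z‖ := by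
  induction z using UniformSpace.Completion.induction_on with
  | hp => exact isClosed_eq (ContinuousLinearMap.continuous _).norm continuous_norm
  | ih z =>
    rw [mapCLM_coe, UniformSpace.Completion.norm_coe, UniformSpace.Completion.norm_coe,
      LinearIsometryEquiv.norm_map]

/-- The unitary operator `a ⊗ b` on `H ⊗ M`. -/
noncomputable def map (a : H ≃ₗᵢ[ℂ] H) (b : M ≃ₗᵢ[ℂ] M) :
    HilbertTensor H M ≃ₗᵢ[ℂ] HilbertTensor H M where
  toFun := mapCLM a b
  map_add' := map_add _
  map_smul' c z := (mapCLM a b).map_smul c z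
  invFun := mapCLM a⁻¹ b⁻¹
  left_inv z := by rw [← mapCLM_mul, inv_mul_cancel, inv_mul_cancel, mapCLM_one_one]
  right_inv z := by rw [← mapCLM_mul, mul_inv_cancel, mul_inv_cancel, mapCLM_one_one]
  norm_map' := norm_mapCLM a b

end HilbertTensor

/-- The tensor product `η ⊗ π` of two unitary representations of `G`, with
`(η ⊗ π)(g) = η(g) ⊗ π(g)` on the Hilbert space tensor product. -/
noncomputable def UnitaryRep.tensor {G : Type u} [Group G] (η : UnitaryRep G H)
    (π : UnitaryRep G M) : UnitaryRep G (HilbertTensor H M) where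
  toFun g := HilbertTensor.map (η g) (π g)
  map_one' := by
    apply LinearIsometryEquiv.ext
    intro z
    change HilbertTensor.mapCLM (η 1) (π 1) z = z
    rw [map_one, map_one, HilbertTensor.mapCLM_one_one]
  map_mul' g h := by
    apply LinearIsometryEquiv.ext
    intro z
    change HilbertTensor.mapCLM (η (g * h)) (π (g * h)) z =
      HilbertTensor.mapCLM (η g) (π g) (HilbertTensor.mapCLM (η h) (π h) z)
    rw [map_mul, map_mul, HilbertTensor.mapCLM_mul]

end HilbertTensor

/-- The unitary operators of `M`, to be equipped with the strong operator topology. -/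
def StrongUnitary (M : Type w) [NormedAddCommGroup M] [InnerProductSpace ℂ M] : Type w :=
  M ≃ₗᵢ[ℂ] M

/-- The underlying unitary operator. -/
def StrongUnitary.toUnitary {M : Type w} [NormedAddCommGroup M] [InnerProductSpace ℂ M]
    (a : StrongUnitary M) : M ≃ₗᵢ[ℂ] M := a

/-- The strong operator topology: the topology of pointwise norm convergence on `M`. -/
instance StrongUnitary.instTopologicalSpace (M : Type w) [NormedAddCommGroup M]
    [InnerProductSpace ℂ M] : TopologicalSpace (StrongUnitary M) :=
  TopologicalSpace.induced (fun (a : StrongUnitary M) (x : M) => a.toUnitary x) Pi.topologicalSpace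

/-- The representation of the free group on `S` that sends each generator `s` to the unitary
operator `a s`. Every unitary representation of the free group arises from exactly one tuple. -/
def UnitaryRep.ofTuple {S : Type u} {M : Type w} [NormedAddCommGroup M] [InnerProductSpace ℂ M]
    (a : S → StrongUnitary M) : UnitaryRep (FreeGroup S) M :=
  FreeGroup.lift fun s => (a s).toUnitary

/-! Reducibility of `η ⊗ π` is witnessed by a self-adjoint contraction `T` in the commutant that is
not scalar. Against a fixed elementary tensor `ω ≠ 0`, being scalar means `⟪T ξ, ζ⟫ ⟪ω, ω⟫ = ⟪T ω,
ω⟫ ⟪ξ, ζ⟫` for all `ξ`, `ζ`. The tuples having a `T` that violates this by at least `δ` form the set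
`nonscalarCommutant`. With `ξ`, `ζ` running over elementary tensors of dense sequences and `δ = 1 /
(n + 1)`, countably many such sets cover the reducible tuples; each is closed with empty interior.

Closedness is weak operator compactness of the unit ball: witnesses for convergent tuples have a
weak limit, which is a witness for the limit tuple.

For empty interior, any tuple is approximated by one whose representation has an irreducible
finite-dimensional subrepresentation `σ` on a subspace containing the `M`-components of `ξ`, `ζ`,
`ω`. Since `η ⊗ σ` is irreducible, Schur's lemma makes the compression of `T` to that block scalar,
so the margin is zero. The approximation cuts the tuple down to finite dimension and then perturbs
two generators: one to have simple spectrum, the other to have no zero matrix coefficient in the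
eigenbasis of the first.

The dense sequence in `H` exists because the trivial `π` makes `H ⊗ ℂ` irreducible, hence separable.
Second category is Baire's theorem, the unitary group being Polish in the strong topology. -/

open Filter Topology

/-! ### Schur's lemma, weak operator compactness and commutants -/

section Schur

variable {G : Type u} [Group G] {K : Type v} [NormedAddCommGroup K] [InnerProductSpace ℂ K]

/-- Schur's lemma for self-adjoint intertwiners. -/
theorem UnitaryRep.IsIrreducible.exists_eq_smul_one [CompleteSpace K] {ρ : UnitaryRep G K}
    (hρ : ρ.IsIrreducible) {T : K →L[ℂ] K} (hT : IsSelfAdjoint T)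
    (hcomm : ∀ g x, T (ρ g x) = ρ g (T x)) : ∃ c : ℂ, T = c • 1 := by
  obtain ⟨hK, hρ⟩ := hρ
  have hc : ∀ f : ℝ → ℝ, ∀ g x, (cfc f T) (ρ g x) = ρ g (cfc f T x) := by
    intro f g x
    have h1 : Commute T (ρ.toOperators g) := by
      ext x; exact hcomm g x
    exact congrArg (fun A : K →L[ℂ] K => A x) (h1.cfc_real f).eq
  obtain ⟨l, hl⟩ := ContinuousFunctionalCalculus.spectrum_nonempty (R := ℝ) T hT
  -- Two spectral points would make the positive and negative parts of `T - c`, at their midpoint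
  -- `c`, both nonzero with product zero. The kernel of one would then be closed, invariant, nonzero
  -- and proper.
  have key : spectrum ℝ T ⊆ {l} := by
    intro m hm
    by_contra hne
    have hne : m ≠ l := hne
    set c := (m + l) / 2 with hcdef
    have hprod : cfc (fun x : ℝ => max 0 (x - c)) T * cfc (fun x : ℝ => max 0 (c - x)) T = 0 := by
      rw [← cfc_mul _ _ T (by fun_prop) (by fun_prop), ← cfc_zero ℝ T]
      congr 1
      funext x
      rcases le_total x c with h | h
      · simp [max_eq_left (sub_nonpos.2 h)]
      · simp [max_eq_left (sub_nonpos.2 h)]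
    have hnz : ∀ f : ℝ → ℝ, Continuous f → (f m ≠ 0 ∨ f l ≠ 0) → cfc f T ≠ 0 := by
      intro f hf h h0
      have hs := cfc_map_spectrum (R := ℝ) f T hT hf.continuousOn
      rw [h0, spectrum.zero_eq] at hs
      rcases h with h | h
      · exact h (by simpa using hs.symm.subset ⟨m, hm, rfl⟩)
      · exact h (by simpa using hs.symm.subset ⟨l, hl, rfl⟩)
    have h1 : cfc (fun x : ℝ => max 0 (x - c)) T ≠ 0 := by
      refine hnz _ (by fun_prop) ?_
      rcases lt_or_gt_of_ne hne with h | h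
      · right; have : 0 < l - c := by rw [hcdef]; linarith
        rw [max_eq_right this.le]; exact this.ne'
      · left; have : 0 < m - c := by rw [hcdef]; linarith
        rw [max_eq_right this.le]; exact this.ne'
    have h2 : cfc (fun x : ℝ => max 0 (c - x)) T ≠ 0 := by
      refine hnz _ (by fun_prop) ?_
      rcases lt_or_gt_of_ne hne with h | h
      · left; have : 0 < c - m := by rw [hcdef]; linarith
        rw [max_eq_right this.le]; exact this.ne'
      · right; have : 0 < c - l := by rw [hcdef]; linarith
        rw [max_eq_right this.le]; exact this.ne'
    set A := cfc (fun x : ℝ => max 0 (x - c)) T with hA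
    set B := cfc (fun x : ℝ => max 0 (c - x)) T
    rcases hρ (LinearMap.ker A.toLinearMap) (ContinuousLinearMap.isClosed_ker A)
      (fun g x hx => by
        have hx : A x = 0 := hx
        change A (ρ g x) = 0
        rw [hA, hc, ← hA, hx, map_zero]) with h | h
    · apply h2
      ext x
      have : B x ∈ LinearMap.ker A.toLinearMap := congrArg (fun C : K →L[ℂ] K => C x) hprod
      rw [h] at this
      simpa using this
    · apply h1
      ext x
      have : x ∈ LinearMap.ker A.toLinearMap := h ▸ Submodule.mem_top
      exact this
  refine ⟨l, ?_⟩
  have := CFC.eq_algebraMap_of_spectrum_subset_singleton (R := ℝ) T l key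
  rw [this, Algebra.algebraMap_eq_smul_one]
  ext x
  simp

/-- Weak operator compactness of the unit ball, along an ultrafilter. -/
theorem exists_tendsto_inner_of_norm_le_one [CompleteSpace K] {α : Type w} (U : Ultrafilter α)
    (T : α → K →L[ℂ] K) (hT : ∀ᶠ a in U, ‖T a‖ ≤ 1) :
    ∃ A : K →L[ℂ] K, ‖A‖ ≤ 1 ∧
      ∀ x y, Tendsto (fun a => inner ℂ (T a x) y) U (𝓝 (inner ℂ (A x) y)) := by
  have hb : ∀ x y : K, ∀ᶠ a in U, ‖inner ℂ (T a x) y‖ ≤ ‖x‖ * ‖y‖ := by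
    intro x y
    filter_upwards [hT] with a ha
    calc ‖inner ℂ (T a x) y‖ ≤ ‖T a x‖ * ‖y‖ := norm_inner_le_norm _ _
      _ ≤ ‖x‖ * ‖y‖ := by gcongr; simpa using (T a).le_of_opNorm_le ha x
  have hex : ∀ x y : K, ∃ z : ℂ, ‖z‖ ≤ ‖x‖ * ‖y‖ ∧
      Tendsto (fun a => inner ℂ (T a x) y) U (𝓝 z) := by
    intro x y
    obtain ⟨z, hz, hz'⟩ := (isCompact_closedBall (0 : ℂ) (‖x‖ * ‖y‖)).ultrafilter_le_nhds
      (U.map (fun a => inner ℂ (T a x) y)) (by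
        rw [le_principal_iff]
        refine mem_map.2 ?_
        filter_upwards [hb x y] with a ha
        simpa using ha)
    exact ⟨z, by simpa using hz, hz'⟩
  -- The pointwise limits form a bounded sesquilinear form, which the Riesz representation turns
  -- into an operator.
  choose B hB hlim using hex
  let L : K →ₗ⋆[ℂ] K →ₗ[ℂ] ℂ := LinearMap.mk₂'ₛₗ (starRingEnd ℂ) (RingHom.id ℂ) B
    (fun x x' y => tendsto_nhds_unique (hlim _ _)
      (by simpa [inner_add_left] using (hlim x y).add (hlim x' y)))
    (fun c x y => tendsto_nhds_unique (hlim _ _)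
      (by simpa [inner_smul_left, mul_comm] using (hlim x y).const_mul (starRingEnd ℂ c)))
    (fun x y y' => tendsto_nhds_unique (hlim _ _)
      (by simpa [inner_add_right] using (hlim x y).add (hlim x y')))
    (fun c x y => tendsto_nhds_unique (hlim _ _)
      (by simpa [inner_smul_right] using (hlim x y).const_mul c))
  let L' : K →L⋆[ℂ] K →L[ℂ] ℂ := L.mkContinuous₂ 1 (fun x y => by simpa [L] using hB x y)
  have hA : ∀ x y, inner ℂ (InnerProductSpace.continuousLinearMapOfBilin L' x) y = B x y := by
    intro x y
    rw [InnerProductSpace.continuousLinearMapOfBilin_apply]; rfl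
  refine ⟨InnerProductSpace.continuousLinearMapOfBilin L', ?_, fun x y => by rw [hA]; exact hlim x y⟩
  refine ContinuousLinearMap.opNorm_le_bound _ zero_le_one fun x => ?_
  rw [one_mul]
  set z := InnerProductSpace.continuousLinearMapOfBilin L' x
  have h1 : ‖z‖ * ‖z‖ ≤ ‖x‖ * ‖z‖ := by
    have := hB x z
    rw [← hA, inner_self_eq_norm_sq_to_K] at this
    rw [← sq]
    simpa using this
  rcases (norm_nonneg z).eq_or_lt with h | h
  · rw [← h]; exact norm_nonneg x
  · exact le_of_mul_le_mul_right h1 h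

/-- A proper closed invariant subspace gives a non-scalar self-adjoint contraction in the
commutant. -/
theorem UnitaryRep.exists_commuting_projection [CompleteSpace K] {ρ : UnitaryRep G K}
    [Nontrivial K] (hρ : ¬ ρ.IsIrreducible) :
    ∃ T : K →L[ℂ] K, ‖T‖ ≤ 1 ∧ IsSelfAdjoint T ∧ (∀ g x, T (ρ g x) = ρ g (T x)) ∧
      ∀ c : ℂ, T ≠ c • 1 := by
  simp only [UnitaryRep.IsIrreducible, not_and, not_forall, not_or] at hρ
  obtain ⟨W, hWc, hW, hbot, htop⟩ := hρ inferInstance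
  have : CompleteSpace W := hWc.completeSpace_coe
  have hW' : ∀ g, ∀ x ∈ Wᗮ, ρ g x ∈ Wᗮ := by
    intro g x hx y hy
    have h1 := hx _ (hW g⁻¹ y hy)
    rw [← (ρ g).inner_map_map] at h1
    have h2 : ρ g (ρ g⁻¹ y) = y := by
      change (ρ g * ρ g⁻¹) y = y
      rw [← map_mul, mul_inv_cancel, map_one]; rfl
    rwa [h2] at h1
  refine ⟨W.starProjection, W.starProjection_norm_le, isSelfAdjoint_starProjection W, ?_, ?_⟩
  · intro g x
    refine (Submodule.eq_starProjection_of_mem_orthogonal (hW g _ (W.starProjection_apply_mem x))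
      ?_)
    rw [← map_sub]
    exact hW' g _ (W.sub_starProjection_mem_orthogonal x)
  · intro c hc
    have h1 : ∀ x ∈ W, c • x = x := by
      intro x hx
      have := Submodule.starProjection_eq_self_iff.2 hx
      rw [hc] at this
      simpa using this
    obtain ⟨x, hx, hx0⟩ := Submodule.exists_mem_ne_zero_of_ne_bot hbot
    have hc1 : c = 1 := by
      have h2 : (c - 1) • x = 0 := by rw [sub_smul, h1 x hx, one_smul, sub_self]
      rcases smul_eq_zero.1 h2 with h | h
      · exact sub_eq_zero.1 h
      · exact absurd h hx0
    apply htop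
    rw [eq_top_iff]
    intro y _
    have := W.starProjection_apply_mem y
    rw [hc, hc1] at this
    simpa using this

end Schur

/-! ### Unitaries supported on an embedded subspace -/

section Corner

variable {V : Type v} [NormedAddCommGroup V] [InnerProductSpace ℂ V] [CompleteSpace V]
  {M : Type w} [NormedAddCommGroup M] [InnerProductSpace ℂ M] [CompleteSpace M]

theorem LinearIsometry.adjoint_apply_self (j : V →ₗᵢ[ℂ] M) (x : V) :
    ContinuousLinearMap.adjoint j.toContinuousLinearMap (j x) = x := by
  refine ext_inner_right ℂ fun y => ?_
  rw [ContinuousLinearMap.adjoint_inner_left]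
  exact j.inner_map_map x y

/-- The unitary operator `j u j⁻¹ ⊕ 1` for an isometric embedding `j`. -/
noncomputable def LinearIsometry.extendUnitary (j : V →ₗᵢ[ℂ] M) :
    (V ≃ₗᵢ[ℂ] V) →* (M ≃ₗᵢ[ℂ] M) :=
  let p := ContinuousLinearMap.adjoint j.toContinuousLinearMap
  let f : (V ≃ₗᵢ[ℂ] V) → M →ₗ[ℂ] M := fun u =>
    { toFun := fun m => m + j (u (p m) - p m)
      map_add' := fun x y => by simp only [map_add, map_sub]; abel
      map_smul' := fun c x => by
        simp only [map_smul, map_sub, smul_add, smul_sub, RingHom.id_apply] }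
  have hmul : ∀ a b m, f (a * b) m = f a (f b m) := fun a b m => by
    have hp : p (m + j (b (p m) - p m)) = b (p m) := by
      rw [map_add, j.adjoint_apply_self]; abel
    change m + j (a (b (p m)) - p m) = (m + j (b (p m) - p m)) +
      j (a (p (m + j (b (p m) - p m))) - p (m + j (b (p m) - p m)))
    rw [hp]
    simp only [map_sub]
    abel
  have hone : ∀ m, f 1 m = m := fun m => by
    change m + j (p m - p m) = m
    simp
  { toFun := fun u =>
      { f u with
        invFun := f u⁻¹
        left_inv := fun m => by
          change f u⁻¹ (f u m) = m
          rw [← hmul, inv_mul_cancel, hone]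
        right_inv := fun m => by
          change f u (f u⁻¹ m) = m
          rw [← hmul, mul_inv_cancel, hone]
        norm_map' := fun m => by
          change ‖m + j (u (p m) - p m)‖ = ‖m‖
          -- The change in squared norm depends only on `p m`: it equals `‖u (p m)‖ ^ 2 - ‖p m‖ ^ 2
          -- = 0`.
          rw [← sq_eq_sq₀ (norm_nonneg _) (norm_nonneg _), @norm_add_sq ℂ]
          have h1 : inner ℂ m (j (u (p m) - p m)) = inner ℂ (p m) (u (p m) - p m) :=
            (ContinuousLinearMap.adjoint_inner_left j.toContinuousLinearMap _ _).symm
          have h2 := @norm_add_sq ℂ _ _ _ _ (p m) (u (p m) - p m)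
          rw [add_sub_cancel, u.norm_map] at h2
          rw [h1, j.norm_map]
          linarith }
    map_one' := LinearIsometryEquiv.ext hone
    map_mul' := fun a b => LinearIsometryEquiv.ext (hmul a b) }

theorem LinearIsometry.extendUnitary_apply (j : V →ₗᵢ[ℂ] M) (u : V ≃ₗᵢ[ℂ] V) (m : M) :
    j.extendUnitary u m = m + j (u (ContinuousLinearMap.adjoint j.toContinuousLinearMap m) -
      ContinuousLinearMap.adjoint j.toContinuousLinearMap m) := rfl

theorem LinearIsometry.extendUnitary_apply_map (j : V →ₗᵢ[ℂ] M) (u : V ≃ₗᵢ[ℂ] V) (x : V) :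
    j.extendUnitary u (j x) = j (u x) := by
  rw [j.extendUnitary_apply, j.adjoint_apply_self, map_sub, add_sub_cancel]

end Corner

/-! ### Density of irreducible tuples in finite dimension -/

section FiniteDimensional

variable {V : Type v} [NormedAddCommGroup V] [InnerProductSpace ℂ V] [FiniteDimensional ℂ V]

omit [FiniteDimensional ℂ V] in
theorem LinearIsometryEquiv.norm_eq_one_of_apply_eq_smul (u : V ≃ₗᵢ[ℂ] V) {x : V} (hx : x ≠ 0)
    {c : ℂ} (h : u x = c • x) : ‖c‖ = 1 := by
  have := u.norm_map x
  rw [h, norm_smul] at this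
  exact (mul_eq_right₀ (norm_ne_zero_iff.2 hx)).1 this

/-- The spectral theorem for unitary operators in finite dimension. -/
theorem LinearIsometryEquiv.exists_orthonormalBasis_eigenvectors (u : V ≃ₗᵢ[ℂ] V) :
    ∃ (n : ℕ) (b : OrthonormalBasis (Fin n) ℂ V) (μ : Fin n → ℂ),
      (∀ i, ‖μ i‖ = 1) ∧ ∀ i, u (b i) = μ i • b i := by
  classical
  set T : Module.End ℂ V := u.toLinearEquiv.toLinearMap
  have hT : ∀ x, T x = u x := fun _ => rfl
  have horth : OrthogonalFamily ℂ (fun μ => Module.End.eigenspace T μ)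
      fun μ => (Module.End.eigenspace T μ).subtypeₗᵢ := by
    rintro c d hcd ⟨x, hx⟩ ⟨y, hy⟩
    rw [Module.End.mem_eigenspace_iff, hT] at hx hy
    change inner ℂ x y = 0
    by_contra hne
    have hx0 : x ≠ 0 := by rintro rfl; simp at hne
    have h1 := u.norm_eq_one_of_apply_eq_smul hx0 hx
    have h2 := u.inner_map_map x y
    rw [hx, hy, inner_smul_left, inner_smul_right, ← mul_assoc] at h2
    have h3 : (starRingEnd ℂ) c * d = 1 := (mul_eq_right₀ hne).1 h2
    have h4 : c * (starRingEnd ℂ) c = 1 := by rw [Complex.mul_conj, Complex.normSq_eq_norm_sq, h1]; simp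
    exact hcd (by rw [← mul_one c, ← h3, ← mul_assoc, h4, one_mul])
  -- The complement of the eigenspaces is invariant, so if nonzero it would contain an eigenvector,
  -- orthogonal to itself.
  have hsup : (⨆ μ, Module.End.eigenspace T μ)ᗮ = ⊥ := by
    set W := (⨆ μ, Module.End.eigenspace T μ)ᗮ with hW
    have hmem : ∀ x, x ∈ W ↔ ∀ μ, ∀ y ∈ Module.End.eigenspace T μ, inner ℂ y x = 0 := by
      intro x
      rw [hW, ← Submodule.iInf_orthogonal]
      simp [Submodule.mem_iInf, Submodule.mem_orthogonal]
    have hinv : ∀ x ∈ W, T x ∈ W := by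
      intro x hx
      rw [hmem] at hx ⊢
      intro c y hy
      by_cases hy0 : y = 0
      · simp [hy0]
      have hy' := hy
      rw [Module.End.mem_eigenspace_iff, hT] at hy'
      have hc := u.norm_eq_one_of_apply_eq_smul hy0 hy'
      have hc0 : c ≠ 0 := by rintro rfl; simp at hc
      have h1 := u.inner_map_map y x
      rw [hx c y hy, hy', inner_smul_left] at h1
      exact (mul_eq_zero.1 h1).resolve_left (by simpa using hc0)
    by_contra hne
    have : Nontrivial W := Submodule.nontrivial_iff_ne_bot.2 hne
    obtain ⟨c, hc⟩ := Module.End.exists_eigenvalue (T.restrict hinv)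
    obtain ⟨x, hx⟩ := hc.exists_hasEigenvector
    have hx1 := hx.apply_eq_smul
    have hx2 : T x = c • (x : V) := congrArg Subtype.val hx1
    have := (hmem x).1 x.2 c x (Module.End.mem_eigenspace_iff.2 hx2)
    exact hx.2 (Subtype.ext (inner_self_eq_zero.1 this))
  have hint : DirectSum.IsInternal fun μ : T.Eigenvalues => Module.End.eigenspace T μ := by
    refine (OrthogonalFamily.isInternal_iff (horth.comp Subtype.val_injective)).2 ?_
    change (⨆ μ : { μ // Module.End.HasEigenvalue T μ }, Module.End.eigenspace T μ)ᗮ = ⊥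
    rw [← hsup]
    congr 1
    refine le_antisymm (iSup_le fun μ => le_iSup (Module.End.eigenspace T) (μ : ℂ)) ?_
    refine iSup_le fun μ => ?_
    by_cases h : Module.End.eigenspace T μ = ⊥
    · rw [h]; exact bot_le
    · exact le_iSup (fun μ : { μ // Module.End.HasEigenvalue T μ } => Module.End.eigenspace T μ)
        ⟨μ, h⟩
  have ho := horth.comp (γ := T.Eigenvalues) Subtype.val_injective
  set b := hint.subordinateOrthonormalBasis rfl ho
  have hb : ∀ i, u (b i) = ((hint.subordinateOrthonormalBasisIndex rfl i ho : T.Eigenvalues) : ℂ) •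
      b i := fun i => by
    have := hint.subordinateOrthonormalBasis_subordinate rfl i ho
    exact Module.End.mem_eigenspace_iff.1 this
  exact ⟨_, b, fun i => _, fun i => u.norm_eq_one_of_apply_eq_smul
    (b.orthonormal.ne_zero i) (hb i), hb⟩

/-- Greedy choice; it supplies distinct eigenvalues close to prescribed ones. -/
theorem exists_injective_forall_mem_of_infinite {α : Type*} {n : ℕ} (A : Fin n → Set α)
    (hA : ∀ i, (A i).Infinite) : ∃ f : Fin n → α, Function.Injective f ∧ ∀ i, f i ∈ A i := by
  induction n with
  | zero => exact ⟨Fin.elim0, fun i => i.elim0, fun i => i.elim0⟩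
  | succ n ih =>
    obtain ⟨f, hf, hfA⟩ := ih (fun i => A i.succ) (fun i => hA i.succ)
    obtain ⟨x, hx, hx'⟩ := ((hA 0).sdiff (Set.finite_range f)).nonempty
    exact ⟨Fin.cons x f, Fin.cons_injective_iff.2 ⟨hx', hf⟩, Fin.cases hx hfA⟩

theorem Complex.infinite_norm_eq_one_near {c : ℂ} (hc : ‖c‖ = 1) {ε : ℝ} (hε : 0 < ε) :
    {z : ℂ | ‖z‖ = 1 ∧ ‖z - c‖ < ε}.Infinite := by
  have : Nontrivial Circle := ⟨1, -1, fun h => by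
    have := congrArg (fun c : Circle => (c : ℂ).re) h
    norm_num at this⟩
  let c' : Circle := ⟨c, mem_sphere_zero_iff_norm.2 hc⟩
  have h : {z : Circle | ‖Circle.coeHom z - c‖ < ε} ∈ 𝓝 c' := by
    have hcont : Continuous fun z : Circle => ‖Circle.coeHom z - c‖ :=
      ((show Continuous fun z : Circle => (z : ℂ) from continuous_subtype_val).sub continuous_const).norm
    refine (isOpen_lt hcont continuous_const).mem_nhds ?_
    change ‖c - c‖ < ε
    simpa using hε
  refine ((infinite_of_mem_nhds c' h).image (f := Circle.coeHom)
    (fun x _ y _ hxy => Circle.ext hxy)).mono ?_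
  rintro _ ⟨z, hz, rfl⟩
  exact ⟨Circle.norm_coe z, hz⟩

/-- Unitaries with simple spectrum are dense. -/
theorem LinearIsometryEquiv.exists_near_simple_spectrum (u : V ≃ₗᵢ[ℂ] V) {ε : ℝ} (hε : 0 < ε) :
    ∃ u' : V ≃ₗᵢ[ℂ] V, (∀ x, ‖u' x - u x‖ ≤ ε * ‖x‖) ∧
      ∃ (n : ℕ) (b : OrthonormalBasis (Fin n) ℂ V) (μ : Fin n → ℂ), Function.Injective μ ∧
        ∀ i, u' (b i) = μ i • b i := by
  obtain ⟨n, b, μ, hμ, hb⟩ := u.exists_orthonormalBasis_eigenvectors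
  -- Each eigenvalue moves by less than `ε / (n + 1)`, so the `n` errors add up to at most `ε`; the
  -- `+ 1` covers `n = 0`.
  have hn : (0 : ℝ) < n + 1 := by positivity
  obtain ⟨μ', hinj, hμ'⟩ := exists_injective_forall_mem_of_infinite
    _ (fun i => Complex.infinite_norm_eq_one_near (hμ i) (div_pos hε hn))
  let f : V →ₗ[ℂ] V := b.toBasis.constr ℂ fun i => μ' i • b i
  have hf : ∀ i, f (b i) = μ' i • b i := fun i => by
    have := b.toBasis.constr_basis ℂ (fun i => μ' i • b i) i
    rwa [b.coe_toBasis] at this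
  have hfo : Orthonormal ℂ (f ∘ b.toBasis) := by
    classical
    rw [orthonormal_iff_ite]
    intro i k
    have := orthonormal_iff_ite.1 b.orthonormal i k
    simp only [Function.comp_apply, OrthonormalBasis.coe_toBasis, hf, inner_smul_left,
      inner_smul_right, this]
    split_ifs with h
    · subst h
      rw [mul_one, Complex.mul_conj, Complex.normSq_eq_norm_sq, (hμ' i).1]
      simp
    · simp
  let F : V →ₗᵢ[ℂ] V := f.isometryOfOrthonormal (v := b.toBasis)
    (by rw [b.coe_toBasis]; exact b.orthonormal) hfo
  refine ⟨F.toLinearIsometryEquiv rfl, ?_, n, b, μ', hinj, hf⟩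
  intro x
  change ‖f x - u x‖ ≤ _
  have hx : f x - u x = ∑ i, b.repr x i • ((μ' i - μ i) • b i) := by
    conv_lhs => rw [← b.sum_repr x]
    rw [map_sum, map_sum, ← Finset.sum_sub_distrib]
    exact Finset.sum_congr rfl fun i _ => by
      rw [f.map_smul, map_smul, hf, hb, sub_smul, smul_sub]
  rw [hx]
  calc ‖∑ i, b.repr x i • ((μ' i - μ i) • b i)‖
      ≤ ∑ i : Fin n, ‖x‖ * (ε / (n + 1)) := by
        refine norm_sum_le_of_le _ fun i _ => ?_
        rw [norm_smul, norm_smul, b.orthonormal.1 i, mul_one]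
        gcongr
        · exact (PiLp.norm_apply_le (b.repr x) i).trans (b.repr.norm_map x).le
        · exact (hμ' i).2.le
    _ = (n / (n + 1)) * (ε * ‖x‖) := by
        rw [Finset.sum_const, Finset.card_univ, Fintype.card_fin, nsmul_eq_mul]; ring
    _ ≤ 1 * (ε * ‖x‖) := by
        gcongr
        rw [div_le_one hn]; linarith
    _ = _ := one_mul _

/-- Small perturbations by rank one rotations make all matrix coefficients nonzero. -/
theorem LinearIsometryEquiv.exists_near_inner_ne_zero [Nontrivial V] (v : V ≃ₗᵢ[ℂ] V) {n : ℕ}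
    (b : OrthonormalBasis (Fin n) ℂ V) {ε : ℝ} (hε : 0 < ε) :
    ∃ v' : V ≃ₗᵢ[ℂ] V, (∀ x, ‖v' x - v x‖ ≤ ε * ‖x‖) ∧
      ∀ i k, inner ℂ (b k) (v' (b i)) ≠ 0 := by
  -- Each condition excludes a proper subspace, and finitely many proper subspaces do not cover `V`.
  obtain ⟨ξ, hξ, hξ1, hξ2⟩ : ∃ ξ : V, ‖ξ‖ = 1 ∧ (∀ i, inner ℂ ξ (b i) ≠ 0) ∧
      ∀ i, inner ℂ (b i) (v ξ) ≠ 0 := by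
    let p : Fin n ⊕ Fin n → Submodule ℂ V := Sum.elim (fun i => (ℂ ∙ b i)ᗮ)
      (fun i => (ℂ ∙ v.symm (b i))ᗮ)
    have hp : ∀ i, p i ≠ ⊤ := by
      have : ∀ y : V, y ≠ 0 → (ℂ ∙ y)ᗮ ≠ ⊤ := by
        intro y hy h
        have : y ∈ (ℂ ∙ y)ᗮ := h ▸ Submodule.mem_top
        rw [Submodule.mem_orthogonal_singleton_iff_inner_right] at this
        exact hy (inner_self_eq_zero.1 this)
      rintro (i | i)
      · exact this _ (b.orthonormal.ne_zero i)
      · exact this _ (by simpa using b.orthonormal.ne_zero i)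
    have hU : (⋃ i, (p i : Set V)) ≠ Set.univ := fun h =>
      (Subspace.exists_eq_top_of_iUnion_eq_univ h).elim fun i hi => hp i hi
    obtain ⟨y, hy⟩ := (Set.ne_univ_iff_exists_notMem _).1 hU
    simp only [Set.mem_iUnion, not_exists, SetLike.mem_coe] at hy
    have hy1 : ∀ i, inner ℂ (b i) y ≠ 0 := fun i h =>
      hy (Sum.inl i) ((Submodule.mem_orthogonal_singleton_iff_inner_right).2 h)
    have hy2 : ∀ i, inner ℂ (b i) (v y) ≠ 0 := fun i h => by
      refine hy (Sum.inr i) ((Submodule.mem_orthogonal_singleton_iff_inner_right).2 ?_)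
      rw [← v.inner_map_map, v.apply_symm_apply]; exact h
    have hy0 : y ≠ 0 := by
      rintro rfl
      obtain ⟨z, hz⟩ := exists_ne (0 : V)
      apply hz
      rw [← b.sum_repr z]
      exact Finset.sum_eq_zero fun i _ => absurd (inner_zero_right _) (hy1 i)
    have hn : ((‖y‖⁻¹ : ℝ) : ℂ) ≠ 0 := by simpa using hy0
    refine ⟨((‖y‖⁻¹ : ℝ) : ℂ) • y, ?_, fun i => ?_, fun i => ?_⟩
    · rw [norm_smul]; simp [hy0]
    · rw [inner_smul_left]
      exact mul_ne_zero (by simpa using hy0) fun h => hy1 i (inner_eq_zero_symm.1 h)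
    · rw [map_smul, inner_smul_right]
      exact mul_ne_zero hn (hy2 i)
  have : CompleteSpace V := FiniteDimensional.complete ℂ V
  -- These are the coefficients of `v` composed with the rotation by `c` along `ξ`. They are affine
  -- in `c` with nonzero slope, so each vanishes for at most one `c`.
  have hfin : (⋃ i, ⋃ k, {c : ℂ | inner ℂ (b k) (v (b i)) +
      (c - 1) * (inner ℂ ξ (b i) * inner ℂ (b k) (v ξ)) = 0}).Finite := by
    refine Set.finite_iUnion fun i => Set.finite_iUnion fun k => Set.Subsingleton.finite ?_
    intro c hc d hd
    have hne := mul_ne_zero (hξ1 i) (hξ2 k)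
    have h := (Set.mem_ofPred_eq ▸ hc : _ = _).trans (Set.mem_ofPred_eq ▸ hd : _ = _).symm
    have h2 := mul_right_cancel₀ hne (add_left_cancel h)
    exact sub_left_injective h2
  obtain ⟨c, ⟨hc, hc1⟩, hc2⟩ := ((Complex.infinite_norm_eq_one_near norm_one hε).sdiff hfin).nonempty
  let r : V →ₗ[ℂ] V := LinearMap.id + (c - 1) • ((innerₛₗ ℂ ξ).smulRight ξ)
  have hr : ∀ x, r x = x + ((c - 1) * inner ℂ ξ x) • ξ := fun x => by
    simp [r, mul_smul]
  have hrn : ∀ x, ‖r x‖ = ‖x‖ := by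
    intro x
    rw [hr, ← sq_eq_sq₀ (norm_nonneg _) (norm_nonneg _), @norm_add_sq ℂ, inner_smul_right,
      norm_smul, hξ, mul_one, norm_mul, ← inner_conj_symm x ξ, mul_assoc, Complex.mul_conj, mul_pow,
      ← Complex.normSq_eq_norm_sq, ← Complex.normSq_eq_norm_sq]
    have hc := Complex.normSq_eq_norm_sq c
    rw [‹‖c‖ = 1›, Complex.normSq_apply] at hc
    have h3 : Complex.normSq (c - 1) = 2 - 2 * c.re := by
      rw [Complex.normSq_apply]
      simp only [Complex.sub_re, Complex.sub_im, Complex.one_re, Complex.one_im, sub_zero]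
      linarith
    rw [h3]
    simp only [RCLike.re_to_complex, Complex.re_mul_ofReal, Complex.sub_re, Complex.one_re]
    ring
  let R : V →ₗᵢ[ℂ] V := ⟨r, hrn⟩
  refine ⟨v * R.toLinearIsometryEquiv rfl, fun x => ?_, fun i k => ?_⟩
  · change ‖v (r x) - v x‖ ≤ _
    rw [← map_sub, v.norm_map, hr, add_sub_cancel_left, norm_smul, hξ, mul_one, norm_mul]
    have h1 : ‖c - 1‖ ≤ ε := le_of_lt hc1
    have h2 : ‖inner ℂ ξ x‖ ≤ ‖x‖ := by simpa [hξ] using norm_inner_le_norm (𝕜 := ℂ) ξ x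
    gcongr
  · change inner ℂ (b k) (v (r (b i))) ≠ 0
    simp only [Set.mem_iUnion, Set.mem_ofPred_eq, not_exists] at hc2
    rw [hr, map_add, map_smul, inner_add_right, inner_smul_right, mul_assoc]
    exact hc2 i k

omit [FiniteDimensional ℂ V] in
-- Lagrange polynomials in `u` are the coordinate projections, so a nonzero `W` contains some `b i`.
-- All coordinates of `v (b i)` are nonzero, so `W` then contains every basis vector.
theorem Submodule.eq_bot_or_eq_top_of_simple_spectrum {n : ℕ} (b : OrthonormalBasis (Fin n) ℂ V)
    {μ : Fin n → ℂ} (hμ : Function.Injective μ) {u v : V →ₗ[ℂ] V} (hu : ∀ i, u (b i) = μ i • b i)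
    (hv : ∀ i k, inner ℂ (b k) (v (b i)) ≠ 0) (W : Submodule ℂ V) (hWu : ∀ x ∈ W, u x ∈ W)
    (hWv : ∀ x ∈ W, v x ∈ W) : W = ⊥ ∨ W = ⊤ := by
  have hpoly : ∀ (P : Polynomial ℂ), ∀ x ∈ W, Polynomial.aeval u P x ∈ W := by
    intro P x hx
    induction P using Polynomial.induction_on' with
    | add P Q hP hQ => rw [map_add]; exact W.add_mem hP hQ
    | monomial k c =>
      rw [Polynomial.aeval_monomial]
      refine W.smul_mem c ?_
      induction k with
      | zero => exact hx
      | succ k ih => rw [pow_succ']; exact hWu _ ih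
  have hcoord : ∀ x ∈ W, ∀ i, b.repr x i ≠ 0 → b i ∈ W := by
    intro x hx i hi
    have h1 := hpoly (Lagrange.basis Finset.univ μ i) x hx
    have h2 : ∀ k, Polynomial.aeval u (Lagrange.basis Finset.univ μ i) (b k) =
        (Lagrange.basis Finset.univ μ i).eval (μ k) • b k := fun k =>
      Module.End.aeval_apply_of_hasEigenvector
        ⟨Module.End.mem_eigenspace_iff.2 (hu k), b.orthonormal.ne_zero k⟩
    rw [← b.sum_repr x, map_sum, Finset.sum_eq_single i] at h1
    · rw [map_smul, h2, Lagrange.eval_basis_self hμ.injOn (Finset.mem_univ i), one_smul] at h1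
      exact (W.smul_mem_iff hi).1 h1
    · intro k _ hk
      rw [map_smul, h2, Lagrange.eval_basis_of_ne hk.symm (Finset.mem_univ k), zero_smul, smul_zero]
    · intro h; exact absurd (Finset.mem_univ i) h
  rcases eq_or_ne W ⊥ with h | h
  · exact Or.inl h
  right
  obtain ⟨x, hx, hx0⟩ := Submodule.exists_mem_ne_zero_of_ne_bot h
  obtain ⟨i, hi⟩ : ∃ i, b.repr x i ≠ 0 := by
    by_contra! hall
    exact hx0 (by rw [← b.sum_repr x]; simp [hall])
  have h1 := hWv _ (hcoord x hx i hi)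
  have h2 : ∀ k, b k ∈ W := fun k => hcoord _ h1 k (by rw [b.repr_apply_apply]; exact hv i k)
  rw [eq_top_iff]
  intro y _
  rw [← b.sum_repr y]
  exact W.sum_mem fun k _ => W.smul_mem _ (h2 k)

/-- Irreducible finite-dimensional representations of a free group are dense. -/
theorem exists_near_irreducible {S : Type u} [Nontrivial S] [Nontrivial V] (a : S → V ≃ₗᵢ[ℂ] V)
    {ε : ℝ} (hε : 0 < ε) : ∃ a' : S → V ≃ₗᵢ[ℂ] V, (∀ s x, ‖a' s x - a s x‖ ≤ ε * ‖x‖) ∧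
      UnitaryRep.IsIrreducible (FreeGroup.lift a' : UnitaryRep (FreeGroup S) V) := by
  classical
  obtain ⟨s, t, hst⟩ := exists_pair_ne S
  obtain ⟨u, hu, n, b, μ, hμ, hub⟩ := (a s).exists_near_simple_spectrum hε
  obtain ⟨v, hv, hvb⟩ := (a t).exists_near_inner_ne_zero b hε
  refine ⟨Function.update (Function.update a s u) t v, fun r x => ?_, inferInstance,
    fun W _ hW => ?_⟩
  · rcases eq_or_ne r t with rfl | hrt
    · rw [Function.update_self]; exact hv x
    rw [Function.update_of_ne hrt]
    rcases eq_or_ne r s with rfl | hrs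
    · rw [Function.update_self]; exact hu x
    · rw [Function.update_of_ne hrs, sub_self, norm_zero]; positivity
  · refine Submodule.eq_bot_or_eq_top_of_simple_spectrum b hμ (u := u.toLinearEquiv.toLinearMap)
      (v := v.toLinearEquiv.toLinearMap) hub hvb W (fun x hx => ?_) fun x hx => ?_
    · have := hW (FreeGroup.of s) x hx
      rwa [FreeGroup.lift_apply_of, Function.update_of_ne hst, Function.update_self] at this
    · have := hW (FreeGroup.of t) x hx
      rwa [FreeGroup.lift_apply_of, Function.update_self] at this

end FiniteDimensional

/-! ### The strong topology: finite-dimensional approximation and Polishness -/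

section StrongUnitary

variable {M : Type w} [NormedAddCommGroup M] [InnerProductSpace ℂ M]

theorem StrongUnitary.continuous_apply (x : M) :
    Continuous fun a : StrongUnitary M => a.toUnitary x :=
  (_root_.continuous_apply x).comp continuous_induced_dom

theorem StrongUnitary.tendsto_nhds_iff {α : Type*} {l : Filter α} {f : α → StrongUnitary M}
    {a : StrongUnitary M} :
    Tendsto f l (𝓝 a) ↔ ∀ x, Tendsto (fun i => (f i).toUnitary x) l (𝓝 (a.toUnitary x)) := by
  rw [nhds_induced, tendsto_comap_iff, tendsto_pi_nhds]
  rfl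

theorem StrongUnitary.exists_finset_of_mem_nhds {a : StrongUnitary M} {U : Set (StrongUnitary M)}
    (hU : U ∈ 𝓝 a) : ∃ X : Finset M, ∀ b : StrongUnitary M,
      (∀ x ∈ X, ‖b.toUnitary x - a.toUnitary x‖ < 1) → b ∈ U := by
  classical
  rw [nhds_induced, nhds_pi,
    ((hasBasis_pi fun x : M => Metric.nhds_basis_ball (x := a.toUnitary x)).comap _).mem_iff] at hU
  obtain ⟨⟨I, r⟩, ⟨hI, hr⟩, hsub⟩ := hU
  -- Dividing `x` by its radius `r x` normalises every tolerance to `1`.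
  refine ⟨hI.toFinset.image fun x => ((r x)⁻¹ : ℂ) • x, fun b hb => hsub ?_⟩
  intro x hx
  have hrx : 0 < r x := hr x hx
  have := hb _ (Finset.mem_image_of_mem _ (hI.mem_toFinset.2 hx))
  rw [map_smul, map_smul, ← smul_sub, norm_smul, norm_inv, Complex.norm_real,
    Real.norm_of_nonneg hrx.le, inv_mul_lt_iff₀ hrx, mul_one] at this
  exact mem_ball_iff_norm.2 this

theorem StrongUnitary.exists_finset_of_mem_nhds_pi {S : Type u} [Finite S]
    {a : S → StrongUnitary M} {U : Set (S → StrongUnitary M)} (hU : U ∈ 𝓝 a) :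
    ∃ X : Finset M, ∀ b : S → StrongUnitary M,
      (∀ s, ∀ x ∈ X, ‖(b s).toUnitary x - (a s).toUnitary x‖ < 1) → b ∈ U := by
  classical
  have := Fintype.ofFinite S
  rw [nhds_pi, Filter.mem_pi] at hU
  obtain ⟨I, _, t, ht, hsub⟩ := hU
  choose X hX using fun s => StrongUnitary.exists_finset_of_mem_nhds (ht s)
  exact ⟨Finset.univ.biUnion X, fun b hb => hsub fun s _ => hX s _ fun x hx =>
    hb s x (Finset.mem_biUnion.2 ⟨s, Finset.mem_univ s, hx⟩)⟩

/-- Each `a s` maps the span of `X` isometrically into the finite-dimensional `F`, and such a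
partial isometry extends to a unitary of `F`. Agreement on `X` is exact. The model `EuclideanSpace ℂ
(Fin d)` lies in `Type`, where the irreducibility hypothesis of the theorem applies. -/
theorem exists_finiteDimensional_dilation {S : Type u} [Finite S] (a : S → M ≃ₗᵢ[ℂ] M)
    (X : Finset M) : ∃ (d : ℕ) (j : EuclideanSpace ℂ (Fin d) →ₗᵢ[ℂ] M)
      (u : S → EuclideanSpace ℂ (Fin d) ≃ₗᵢ[ℂ] EuclideanSpace ℂ (Fin d)),
      ∀ x ∈ X, ∃ v, j v = x ∧ ∀ s, j (u s v) = a s x := by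
  set F₀ : Submodule ℂ M := Submodule.span ℂ X
  set F : Submodule ℂ M := F₀ ⊔ ⨆ s, F₀.map (a s).toLinearEquiv.toLinearMap
  let e := (stdOrthonormalBasis ℂ F).repr
  let j : EuclideanSpace ℂ (Fin (Module.finrank ℂ F)) →ₗᵢ[ℂ] M :=
    F.subtypeₗᵢ.comp e.symm.toLinearIsometry
  have hj : ∀ y : F, j (e y) = y := fun y => congrArg Subtype.val (e.symm_apply_apply y)
  let W := F₀.comap j.toLinearMap
  have hW : ∀ s, ∀ w : W, a s (j w) ∈ F := fun s w =>
    (le_sup_of_le_right (le_iSup (fun s => F₀.map (a s).toLinearEquiv.toLinearMap) s) :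
      F₀.map (a s).toLinearEquiv.toLinearMap ≤ F) ⟨_, w.2, rfl⟩
  let L : S → W →ₗᵢ[ℂ] EuclideanSpace ℂ (Fin (Module.finrank ℂ F)) := fun s =>
    e.toLinearIsometry.comp
      { toLinearMap := LinearMap.codRestrict F
          ((a s).toLinearEquiv.toLinearMap ∘ₗ j.toLinearMap ∘ₗ W.subtype) (hW s)
        norm_map' := fun w => ((a s).norm_map _).trans (j.norm_map _) }
  refine ⟨_, j, fun s => (L s).extend.toLinearIsometryEquiv rfl, fun x hx => ?_⟩
  have hx₀ : x ∈ F₀ := Submodule.subset_span hx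
  have hxF : x ∈ F := (le_sup_left : F₀ ≤ F) hx₀
  have hjx := hj ⟨x, hxF⟩
  refine ⟨e ⟨x, hxF⟩, hjx, fun s => ?_⟩
  have hw : e ⟨x, hxF⟩ ∈ W := by
    change j (e ⟨x, hxF⟩) ∈ F₀
    rw [hjx]; exact hx₀
  change j ((L s).extend (⟨e ⟨x, hxF⟩, hw⟩ : W)) = _
  rw [LinearIsometry.extend_apply]
  refine (hj _).trans ?_
  change a s (j (e ⟨x, hxF⟩)) = a s x
  rw [hjx]

/-- Every neighbourhood of a tuple contains a tuple with an irreducible finite-dimensional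
subrepresentation on a space containing prescribed vectors. -/
theorem exists_mem_nhds_irreducible_subrepresentation [CompleteSpace M] {S : Type u} [Finite S]
    [Nontrivial S] {a : S → StrongUnitary M} {U : Set (S → StrongUnitary M)} (hU : U ∈ 𝓝 a)
    (Y : Finset M) {y : M} (hy : y ∈ Y) (hy0 : y ≠ 0) :
    ∃ b ∈ U, ∃ (d : ℕ) (j : EuclideanSpace ℂ (Fin d) →ₗᵢ[ℂ] M)
      (σ : UnitaryRep (FreeGroup S) (EuclideanSpace ℂ (Fin d))), σ.IsIrreducible ∧
      (∀ x ∈ Y, ∃ v, j v = x) ∧ ∀ g v, UnitaryRep.ofTuple b g (j v) = j (σ g v) := by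
  classical
  obtain ⟨X, hX⟩ := StrongUnitary.exists_finset_of_mem_nhds_pi hU
  obtain ⟨d, j, u, hu⟩ := exists_finiteDimensional_dilation (fun s => (a s).toUnitary) (X ∪ Y)
  have : Nontrivial (EuclideanSpace ℂ (Fin d)) := by
    obtain ⟨v, hv, _⟩ := hu y (Finset.mem_union_right _ hy)
    exact ⟨v, 0, fun h => hy0 (by rw [← hv, h, map_zero])⟩
  -- A relative error of `(1 + ∑ ‖x‖)⁻¹` moves each vector of `X` by less than `1`.
  have hpos : 0 < 1 + ∑ x ∈ X, ‖x‖ := by positivity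
  obtain ⟨u', hu', hirr⟩ := exists_near_irreducible u (inv_pos.2 hpos)
  refine ⟨fun s => (j.extendUnitary (u' s) : M ≃ₗᵢ[ℂ] M), hX _ fun s x hx => ?_, d, j, _, hirr,
    fun x hx => (hu x (Finset.mem_union_right _ hx)).imp fun _ h => h.1, fun g v => ?_⟩
  · obtain ⟨v, rfl, hv⟩ := hu x (Finset.mem_union_left _ hx)
    change ‖j.extendUnitary (u' s) (j v) - (a s).toUnitary (j v)‖ < 1
    rw [j.extendUnitary_apply_map, ← hv s, ← map_sub, j.norm_map]
    refine (hu' s v).trans_lt ?_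
    rw [inv_mul_lt_iff₀ hpos, mul_one, ← j.norm_map]
    have := Finset.single_le_sum (f := fun x : M => ‖x‖) (fun _ _ => norm_nonneg _) hx
    linarith
  · have h : UnitaryRep.ofTuple (fun s => (j.extendUnitary (u' s) : M ≃ₗᵢ[ℂ] M)) =
        (j.extendUnitary).comp (FreeGroup.lift u') := by
      apply FreeGroup.ext_hom
      intro s
      refine (FreeGroup.lift_apply_of (f := fun s => j.extendUnitary (u' s)) (x := s)).trans ?_
      rw [MonoidHom.comp_apply, FreeGroup.lift_apply_of]
    rw [h]
    exact j.extendUnitary_apply_map _ _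

/-- Isometries are equicontinuous, so the Cauchy property spreads from `D` to `M`. The limit is
isometric but may fail to be surjective. -/
theorem LinearIsometryEquiv.exists_tendsto_of_dense [CompleteSpace M] {α : Type*} {l : Filter α}
    [l.NeBot] (f : α → M ≃ₗᵢ[ℂ] M) {D : Set M} (hD : Dense D)
    (h : ∀ x ∈ D, ∃ y, Tendsto (fun i => f i x) l (𝓝 y)) :
    ∃ A : M →ₗᵢ[ℂ] M, ∀ x, Tendsto (fun i => f i x) l (𝓝 (A x)) := by
  have hall : ∀ x, ∃ y, Tendsto (fun i => f i x) l (𝓝 y) := by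
    intro x
    refine cauchy_map_iff_exists_tendsto.1 (Metric.cauchy_iff.2 ⟨inferInstance, fun ε hε => ?_⟩)
    obtain ⟨z, hzD, hz⟩ := hD.exists_dist_lt x (show 0 < ε / 4 by positivity)
    obtain ⟨y, hy⟩ := h z hzD
    refine ⟨_, image_mem_map (hy (Metric.ball_mem_nhds y (show 0 < ε / 4 by positivity))), ?_⟩
    rintro _ ⟨i, hi, rfl⟩ _ ⟨k, hk, rfl⟩
    have hi : dist (f i z) y < ε / 4 := hi
    have hk : dist (f k z) y < ε / 4 := hk
    have h1 : dist (f i x) (f i z) < ε / 4 := by rwa [(f i).dist_map]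
    have h2 : dist (f k x) (f k z) < ε / 4 := by rwa [(f k).dist_map]
    calc dist (f i x) (f k x) ≤ dist (f i x) (f i z) + dist (f i z) y + dist y (f k z) +
          dist (f k z) (f k x) := by
          linarith [dist_triangle (f i x) (f i z) y, dist_triangle (f i x) y (f k z),
            dist_triangle (f i x) (f k z) (f k x)]
      _ < ε := by rw [dist_comm y, dist_comm _ (f k x)]; linarith
  choose A hA using hall
  exact ⟨{ toFun := A
           map_add' := fun x y => tendsto_nhds_unique (hA _)
            (by simpa using (hA x).add (hA y))
           map_smul' := fun c x => tendsto_nhds_unique (hA _)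
            (by simpa using (hA x).const_smul c)
           norm_map' := fun x => tendsto_nhds_unique (hA x).norm
            (by simp) }, hA⟩

theorem StrongUnitary.tendsto_inv {α : Type*} {l : Filter α} {f : α → StrongUnitary M}
    {a : StrongUnitary M} (h : Tendsto f l (𝓝 a)) (x : M) :
    Tendsto (fun i => (f i).toUnitary.symm x) l (𝓝 (a.toUnitary.symm x)) := by
  rw [tendsto_iff_norm_sub_tendsto_zero]
  have h1 := tendsto_iff_norm_sub_tendsto_zero.1
    (StrongUnitary.tendsto_nhds_iff.1 h (a.toUnitary.symm x))
  refine h1.congr fun i => ?_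
  rw [LinearIsometryEquiv.apply_symm_apply, ← (f i).toUnitary.norm_map (_ - a.toUnitary.symm x),
    map_sub, LinearIsometryEquiv.apply_symm_apply, norm_sub_rev]

/-- A strong limit of unitaries may lose surjectivity. Recording inverses as well as values on a
dense sequence repairs this: the limit of the inverses inverts the limit, so the image in a
countable product of copies of `M × M` is closed. -/
instance StrongUnitary.instPolishSpace [CompleteSpace M] [TopologicalSpace.SeparableSpace M] :
    PolishSpace (StrongUnitary M) := by
  let D := TopologicalSpace.denseSeq M
  have hD : Dense (Set.range D) := TopologicalSpace.denseRange_denseSeq M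
  let φ : StrongUnitary M → ℕ → M × M := fun a n => (a.toUnitary (D n), a.toUnitary.symm (D n))
  -- Stated for arbitrary filters so as to give both that `φ` is inducing and that its range is
  -- closed.
  have hlim : ∀ (l : Filter (StrongUnitary M)) [l.NeBot] (p : ℕ → M × M), Tendsto φ l (𝓝 p) →
      ∃ a, φ a = p ∧ l ≤ 𝓝 a := by
    intro l _ p hp
    rw [tendsto_pi_nhds] at hp
    have hp1 : ∀ n, Tendsto (fun a : StrongUnitary M => a.toUnitary (D n)) l (𝓝 (p n).1) :=
      fun n => (continuous_fst.tendsto _).comp (hp n)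
    have hp2 : ∀ n, Tendsto (fun a : StrongUnitary M => a.toUnitary.symm (D n)) l (𝓝 (p n).2) :=
      fun n => (continuous_snd.tendsto _).comp (hp n)
    obtain ⟨A, hA⟩ := LinearIsometryEquiv.exists_tendsto_of_dense
      (fun a : StrongUnitary M => a.toUnitary) hD (by rintro _ ⟨n, rfl⟩; exact ⟨_, hp1 n⟩)
    obtain ⟨B, hB⟩ := LinearIsometryEquiv.exists_tendsto_of_dense
      (fun a : StrongUnitary M => a.toUnitary.symm) hD (by rintro _ ⟨n, rfl⟩; exact ⟨_, hp2 n⟩)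
    have hAB : ∀ x, A (B x) = x := fun x => by
      refine tendsto_nhds_unique (hA (B x)) ?_
      rw [tendsto_iff_norm_sub_tendsto_zero]
      refine (tendsto_iff_norm_sub_tendsto_zero.1 (hB x)).congr fun a => ?_
      rw [← a.toUnitary.norm_map, map_sub, LinearIsometryEquiv.apply_symm_apply, norm_sub_rev]
    let a : M ≃ₗᵢ[ℂ] M := LinearIsometryEquiv.ofSurjective A fun x => ⟨B x, hAB x⟩
    have hla : l ≤ 𝓝 (show StrongUnitary M from a) :=
      tendsto_id'.1 (StrongUnitary.tendsto_nhds_iff.2 hA)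
    refine ⟨a, funext fun n => Prod.ext ?_ ?_, hla⟩
    · exact tendsto_nhds_unique (hA _) (hp1 n)
    · exact tendsto_nhds_unique (StrongUnitary.tendsto_inv (tendsto_id'.2 hla) _) (hp2 n)
  have hcont : Continuous φ := continuous_pi fun n =>
    (StrongUnitary.continuous_apply _).prodMk
      (continuous_iff_continuousAt.2 fun a => StrongUnitary.tendsto_inv tendsto_id _)
  have hinj : Function.Injective φ := by
    intro a b hab
    refine LinearIsometryEquiv.ext fun x => ?_
    exact congrFun ((TopologicalSpace.denseRange_denseSeq M).equalizer a.toUnitary.continuous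
      b.toUnitary.continuous (funext fun n => congrArg Prod.fst (congrFun hab n))) x
  have hind : IsInducing φ := by
    refine isInducing_iff_nhds.2 fun a => le_antisymm (hcont.tendsto a).le_comap ?_
    refine le_iff_ultrafilter.2 fun g hg => ?_
    obtain ⟨b, hb, hgb⟩ := hlim g (φ a) (tendsto_iff_comap.2 hg)
    rwa [hinj hb] at hgb
  have hclosed : IsClosed (Set.range φ) := by
    refine isClosed_of_closure_subset fun p hp => ?_
    have : (comap φ (𝓝 p)).NeBot := comap_neBot_iff.2 fun t ht => by
      obtain ⟨_, h1, a, rfl⟩ := mem_closure_iff_nhds.1 hp t ht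
      exact ⟨a, h1⟩
    obtain ⟨a, ha, _⟩ := hlim (comap φ (𝓝 p)) p tendsto_comap
    exact ⟨a, ha⟩
  exact (⟨⟨hind, hinj⟩, hclosed⟩ : IsClosedEmbedding φ).polishSpace

end StrongUnitary

/-! ### Weak limits, intertwining on generators, separability -/

section Limits

variable {K : Type v} [NormedAddCommGroup K] [InnerProductSpace ℂ K]

omit [InnerProductSpace ℂ K] in
theorem isClosed_setOf_tendsto_isometry {α : Type*} {l : Filter α} (f : α → K → K) (g : K → K)
    (hf : ∀ i, Isometry (f i)) (hg : Isometry g) :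
    IsClosed {z | Tendsto (fun i => f i z) l (𝓝 (g z))} := by
  refine isClosed_of_closure_subset fun z hz => ?_
  refine Metric.tendsto_nhds.2 fun ε hε => ?_
  obtain ⟨w, hw, hzw⟩ := Metric.mem_closure_iff.1 hz (ε / 3) (by positivity)
  filter_upwards [Metric.tendsto_nhds.1 hw (ε / 3) (by positivity)] with i hi
  have h1 := (hf i).dist_eq z w
  have h2 := hg.dist_eq w z
  rw [dist_comm w z] at h2
  linarith [dist_triangle4 (f i z) (f i w) (g w) (g z)]

/-- Needed because, in the invariance condition on `T`, the vectors move together with the tuple. -/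
theorem tendsto_inner_of_weak_of_norm {α : Type*} {l : Filter α} {T : α → K →L[ℂ] K}
    {A : K →L[ℂ] K} (hT : ∀ᶠ i in l, ‖T i‖ ≤ 1)
    (hA : ∀ x y, Tendsto (fun i => inner ℂ (T i x) y) l (𝓝 (inner ℂ (A x) y)))
    {x y : α → K} {x₀ y₀ : K} (hx : Tendsto x l (𝓝 x₀)) (hy : Tendsto y l (𝓝 y₀)) :
    Tendsto (fun i => inner ℂ (T i (x i)) (y i)) l (𝓝 (inner ℂ (A x₀) y₀)) := by
  have h1 : Tendsto (fun i => inner ℂ (T i (x i - x₀)) (y i)) l (𝓝 0) := by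
    refine squeeze_zero_norm' (a := fun i => ‖x i - x₀‖ * ‖y i‖) ?_ ?_
    · filter_upwards [hT] with i hi
      refine (norm_inner_le_norm _ _).trans ?_
      gcongr
      simpa using (T i).le_of_opNorm_le hi (x i - x₀)
    · simpa using (tendsto_iff_norm_sub_tendsto_zero.1 hx).mul hy.norm
  have h2 : Tendsto (fun i => inner ℂ (T i x₀) (y i - y₀)) l (𝓝 0) := by
    refine squeeze_zero_norm' (a := fun i => ‖x₀‖ * ‖y i - y₀‖) ?_ ?_
    · filter_upwards [hT] with i hi
      refine (norm_inner_le_norm _ _).trans ?_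
      gcongr
      simpa using (T i).le_of_opNorm_le hi x₀
    · simpa using (tendsto_iff_norm_sub_tendsto_zero.1 hy).const_mul ‖x₀‖
  have h3 := (h1.add h2).add (hA x₀ y₀)
  simp only [zero_add] at h3
  refine h3.congr fun i => ?_
  rw [map_sub, inner_sub_left, inner_sub_right]
  ring

theorem ContinuousLinearMap.exists_inner_compression [CompleteSpace K] {E : Type w}
    [NormedAddCommGroup E] [InnerProductSpace ℂ E] [CompleteSpace E] (j : E →L[ℂ] K)
    (T : K →L[ℂ] K) :
    ∃ A : E →L[ℂ] E, ∀ z z', inner ℂ (A z) z' = inner ℂ (T (j z)) (j z') :=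
  ⟨(ContinuousLinearMap.adjoint j).comp (T.comp j), fun z z' =>
    ContinuousLinearMap.adjoint_inner_left j z' (T (j z))⟩

/-- Invariance of the form, unlike commutation, passes directly to weak limits and compressions;
surjectivity of `ρ` recovers commutation from it. -/
theorem ContinuousLinearMap.comm_of_inner_invariant (ρ : K ≃ₗᵢ[ℂ] K) {T : K →L[ℂ] K}
    (h : ∀ x y, inner ℂ (T (ρ x)) (ρ y) = inner ℂ (T x) y) (x : K) : T (ρ x) = ρ (T x) := by
  refine ext_inner_right ℂ fun y => ?_
  obtain ⟨y, rfl⟩ := ρ.surjective y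
  rw [h, ρ.inner_map_map]

theorem UnitaryRep.comm_of_comm_of {S : Type u} {ρ : UnitaryRep (FreeGroup S) K} {T : K →L[ℂ] K}
    (h : ∀ s x, T (ρ (FreeGroup.of s) x) = ρ (FreeGroup.of s) (T x)) (g : FreeGroup S) (x : K) :
    T (ρ g x) = ρ g (T x) := by
  induction g using FreeGroup.induction_on generalizing x with
  | C1 => rw [map_one]; rfl
  | of s => exact h s x
  | inv_of s hs =>
    apply (ρ (FreeGroup.of s)).injective
    have hinv : ∀ z, ρ (FreeGroup.of s) (ρ (FreeGroup.of s)⁻¹ z) = z := fun z => by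
      change (ρ (FreeGroup.of s) * ρ (FreeGroup.of s)⁻¹) z = z
      rw [← map_mul, mul_inv_cancel, map_one]; rfl
    rw [← h, hinv, hinv]
  | mul a b ha hb =>
    rw [map_mul]
    change T (ρ a (ρ b x)) = ρ a (ρ b (T x))
    rw [ha, hb]

/-- The closed span of the countable orbit of a nonzero vector is invariant, hence everything. -/
theorem UnitaryRep.IsIrreducible.separableSpace {G : Type u} [Group G] [Countable G]
    {ρ : UnitaryRep G K} (hρ : ρ.IsIrreducible) : TopologicalSpace.SeparableSpace K := by
  obtain ⟨hK, hρ⟩ := hρ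
  obtain ⟨v, hv⟩ := exists_ne (0 : K)
  set W := Submodule.span ℂ (Set.range fun g => ρ g v)
  have hW : ∀ g, W ≤ W.comap (ρ g).toLinearEquiv.toLinearMap := fun g => by
    refine Submodule.span_le.2 ?_
    rintro _ ⟨h, rfl⟩
    refine Submodule.subset_span ⟨g * h, ?_⟩
    change ρ (g * h) v = ρ g (ρ h v)
    rw [map_mul]; rfl
  rcases hρ W.topologicalClosure W.isClosed_topologicalClosure (fun g x hx =>
    map_mem_closure (ρ g).continuous hx fun y hy => hW g hy) with h | h
  · exfalso
    have h1 : v ∈ W.topologicalClosure := W.le_topologicalClosure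
      (Submodule.subset_span ⟨1, by change ρ 1 v = v; rw [map_one]; rfl⟩)
    rw [h] at h1
    exact hv h1
  · have h1 : TopologicalSpace.IsSeparable (W.topologicalClosure : Set K) :=
      ((Set.countable_range _).isSeparable.span (R := ℂ)).closure
    rw [h] at h1
    exact TopologicalSpace.isSeparable_univ_iff.1 h1

end Limits

/-! ### Operators on the Hilbert space tensor product -/

namespace HilbertTensor

variable {H : Type v} [NormedAddCommGroup H] [InnerProductSpace ℂ H]
  {M : Type w} [NormedAddCommGroup M] [InnerProductSpace ℂ M]

theorem clm_ext {E : Type*} [NormedAddCommGroup E] [NormedSpace ℂ E]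
    {A B : HilbertTensor H M →L[ℂ] E}
    (h : ∀ x y, A ((x ⊗ₜ[ℂ] y : H ⊗[ℂ] M) : HilbertTensor H M) =
      B ((x ⊗ₜ[ℂ] y : H ⊗[ℂ] M) : HilbertTensor H M)) : A = B := by
  ext z
  induction z using UniformSpace.Completion.induction_on with
  | hp => exact isClosed_eq A.continuous B.continuous
  | ih z =>
    induction z using TensorProduct.induction_on with
    | zero => rw [UniformSpace.Completion.coe_zero, map_zero, map_zero]
    | tmul x y => exact h x y
    | add x y hx hy => rw [UniformSpace.Completion.coe_add, map_add, map_add, hx, hy]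

theorem eq_zero_of_inner_tmul {A : HilbertTensor H M →L[ℂ] HilbertTensor H M}
    (h : ∀ x y x' y', inner ℂ (A ((x ⊗ₜ[ℂ] y : H ⊗[ℂ] M) : HilbertTensor H M))
      ((x' ⊗ₜ[ℂ] y' : H ⊗[ℂ] M) : HilbertTensor H M) = 0) : A = 0 := by
  refine clm_ext fun x y => ?_
  have h1 : innerSL ℂ (A ((x ⊗ₜ[ℂ] y : H ⊗[ℂ] M) : HilbertTensor H M)) = 0 :=
    clm_ext fun x' y' => h x y x' y'
  refine ext_inner_right ℂ fun z => ?_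
  have := congrArg (fun f : HilbertTensor H M →L[ℂ] ℂ => f z) h1
  simpa using this

theorem continuous_coe_tmul :
    Continuous fun p : H × M => ((p.1 ⊗ₜ[ℂ] p.2 : H ⊗[ℂ] M) : HilbertTensor H M) :=
  (UniformSpace.Completion.continuous_coe _).comp TensorProduct.continuous_tmul

theorem norm_coe_tmul (x : H) (y : M) :
    ‖((x ⊗ₜ[ℂ] y : H ⊗[ℂ] M) : HilbertTensor H M)‖ = ‖x‖ * ‖y‖ := by
  rw [UniformSpace.Completion.norm_coe, TensorProduct.norm_tmul]

/-- The operators are isometric, so convergence need only be checked on elementary tensors and their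
sums. -/
theorem tendsto_mapCLM {α : Type*} {l : Filter α} {f : α → StrongUnitary M} {a : StrongUnitary M}
    (h : Tendsto f l (𝓝 a)) (u : H ≃ₗᵢ[ℂ] H) (z : HilbertTensor H M) :
    Tendsto (fun i => mapCLM u (f i).toUnitary z) l (𝓝 (mapCLM u a.toUnitary z)) := by
  have hiso : ∀ b : M ≃ₗᵢ[ℂ] M, Isometry (mapCLM u b : HilbertTensor H M → HilbertTensor H M) :=
    fun b => AddMonoidHomClass.isometry_of_norm _ (norm_mapCLM u b)
  induction z using UniformSpace.Completion.induction_on with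
  | hp => exact isClosed_setOf_tendsto_isometry _ _ (fun i => hiso _) (hiso _)
  | ih z =>
    induction z using TensorProduct.induction_on with
    | zero =>
      simp only [UniformSpace.Completion.coe_zero, map_zero]
      exact tendsto_const_nhds
    | tmul x y =>
      have h1 : Tendsto (fun i => (u x, (f i).toUnitary y)) l (𝓝 (u x, a.toUnitary y)) :=
        tendsto_const_nhds.prodMk_nhds (StrongUnitary.tendsto_nhds_iff.1 h y)
      have h2 := ((continuous_coe_tmul (H := H) (M := M)).tendsto (u x, a.toUnitary y)).comp h1
      simpa only [mapCLM_tmul, Function.comp_def] using h2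
    | add x y hx hy =>
      simp only [UniformSpace.Completion.coe_add, map_add]
      exact hx.add hy

/-- The isometric embedding `1 ⊗ j`. -/
noncomputable def embed (H : Type v) [NormedAddCommGroup H] [InnerProductSpace ℂ H]
    {V : Type u} [NormedAddCommGroup V] [InnerProductSpace ℂ V] (j : V →ₗᵢ[ℂ] M) :
    HilbertTensor H V →L[ℂ] HilbertTensor H M :=
  (TensorProduct.mapIsometry (LinearIsometry.id (R := ℂ) (E := H)) j).toContinuousLinearMap.completion

section Embed

variable {V : Type u} [NormedAddCommGroup V] [InnerProductSpace ℂ V] (j : V →ₗᵢ[ℂ] M)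

theorem embed_tmul (x : H) (y : V) :
    embed H j ((x ⊗ₜ[ℂ] y : H ⊗[ℂ] V) : HilbertTensor H V) =
      ((x ⊗ₜ[ℂ] j y : H ⊗[ℂ] M) : HilbertTensor H M) :=
  ContinuousLinearMap.completion_apply_coe _ _

theorem norm_embed (z : HilbertTensor H V) : ‖embed H j z‖ = ‖z‖ := by
  induction z using UniformSpace.Completion.induction_on with
  | hp => exact isClosed_eq (ContinuousLinearMap.continuous _).norm continuous_norm
  | ih z =>
    rw [embed, ContinuousLinearMap.completion_apply_coe, UniformSpace.Completion.norm_coe,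
      UniformSpace.Completion.norm_coe]
    exact LinearIsometry.norm_map _ z

theorem inner_embed (z z' : HilbertTensor H V) :
    inner ℂ (embed H j z) (embed H j z') = inner ℂ z z' :=
  LinearIsometry.inner_map_map ⟨(embed H j).toLinearMap, norm_embed j⟩ z z'

theorem embed_tensor {G : Type*} [Group G] {η : UnitaryRep G H} {σ : UnitaryRep G V}
    {π : UnitaryRep G M} (h : ∀ g v, π g (j v) = j (σ g v)) (g : G) (z : HilbertTensor H V) :
    embed H j (η.tensor σ g z) = η.tensor π g (embed H j z) := by
  change ((embed H j).comp (mapCLM (η g) (σ g))) z = ((mapCLM (η g) (π g)).comp (embed H j)) z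
  congr 1
  refine clm_ext fun x y => ?_
  simp only [ContinuousLinearMap.comp_apply, mapCLM_tmul, embed_tmul, h]

end Embed

end HilbertTensor

/-! ### Reducible tuples as a countable union of nowhere dense closed sets -/

section Generic

variable {S : Type u} {H : Type v} [NormedAddCommGroup H] [InnerProductSpace ℂ H]
  {M : Type w} [NormedAddCommGroup M] [InnerProductSpace ℂ M]

theorem UnitaryRep.tensor_ofTuple_of (η : UnitaryRep (FreeGroup S) H) (a : S → StrongUnitary M)
    (s : S) (z : HilbertTensor H M) : η.tensor (UnitaryRep.ofTuple a) (FreeGroup.of s) z =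
      HilbertTensor.mapCLM (η (FreeGroup.of s)) (a s).toUnitary z := by
  have : UnitaryRep.ofTuple a (FreeGroup.of s) = (a s).toUnitary := FreeGroup.lift_apply_of ..
  rw [← this]; rfl

/-- The tuples for which some self-adjoint contraction in the commutant is non-scalar by a margin
`δ`, as seen by the vectors `ξ`, `ζ` and `ω`. -/
def nonscalarCommutant (η : UnitaryRep (FreeGroup S) H) (ξ ζ ω : HilbertTensor H M) (δ : ℝ) :
    Set (S → StrongUnitary M) :=
  {a | ∃ T : HilbertTensor H M →L[ℂ] HilbertTensor H M, ‖T‖ ≤ 1 ∧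
    (∀ x y, inner ℂ (T x) y = inner ℂ x (T y)) ∧
    (∀ s x y, inner ℂ (T (HilbertTensor.mapCLM (η (FreeGroup.of s)) (a s).toUnitary x))
      (HilbertTensor.mapCLM (η (FreeGroup.of s)) (a s).toUnitary y) = inner ℂ (T x) y) ∧
    δ ≤ ‖inner ℂ (T ξ) ζ * inner ℂ ω ω - inner ℂ (T ω) ω * inner ℂ ξ ζ‖}

theorem isClosed_nonscalarCommutant (η : UnitaryRep (FreeGroup S) H) (ξ ζ ω : HilbertTensor H M)
    (δ : ℝ) : IsClosed (nonscalarCommutant η ξ ζ ω δ) := by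
  refine isClosed_iff_ultrafilter.2 fun a U hU hmem => ?_
  -- One witness per tuple, with the junk value `0` off the set, which is `U`-negligible.
  have hex : ∀ b, ∃ T, b ∈ nonscalarCommutant η ξ ζ ω δ → _ := fun b => by
    by_cases hb : b ∈ nonscalarCommutant η ξ ζ ω δ
    · exact hb.imp fun _ h _ => h
    · exact ⟨0, fun h => absurd h hb⟩
  choose T hT using hex
  have hT1 : ∀ᶠ b in U, ‖T b‖ ≤ 1 := mem_of_superset hmem fun b hb => (hT b hb).1
  obtain ⟨A, hA1, hA⟩ := exists_tendsto_inner_of_norm_le_one U T hT1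
  refine ⟨A, hA1, fun x y => ?_, fun s x y => ?_, ?_⟩
  · refine tendsto_nhds_unique (hA x y) ?_
    have h1 := (Complex.continuous_conj.tendsto _).comp (hA y x)
    rw [inner_conj_symm] at h1
    refine h1.congr' (mem_of_superset hmem fun b hb => ?_)
    change (starRingEnd ℂ) _ = _
    rw [inner_conj_symm, ← (hT b hb).2.1]
  · have hs : Tendsto (fun b : S → StrongUnitary M => b s) U (𝓝 (a s)) :=
      ((continuous_apply s).tendsto a).mono_left hU
    refine tendsto_nhds_unique (tendsto_inner_of_weak_of_norm hT1 hA
      (HilbertTensor.tendsto_mapCLM hs _ x) (HilbertTensor.tendsto_mapCLM hs _ y)) ?_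
    exact (hA x y).congr' (mem_of_superset hmem fun b hb => ((hT b hb).2.2.1 s x y).symm)
  · exact ge_of_tendsto (((hA ξ ζ).mul_const _).sub ((hA ω ω).mul_const _)).norm
      (mem_of_superset hmem fun b hb => (hT b hb).2.2.2)

/-- The range of `embed H j` need not be invariant under `T`, but the compression of `T` to it still
commutes with `η ⊗ σ`, so Schur's lemma applies. -/
theorem HilbertTensor.exists_inner_embed_eq {G : Type*} [Group G] {V : Type*}
    [NormedAddCommGroup V] [InnerProductSpace ℂ V] {j : V →ₗᵢ[ℂ] M} {η : UnitaryRep G H}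
    {σ : UnitaryRep G V} {π : UnitaryRep G M} (hσ : (η.tensor σ).IsIrreducible)
    (hj : ∀ g v, π g (j v) = j (σ g v)) {T : HilbertTensor H M →L[ℂ] HilbertTensor H M}
    (hT : ∀ x y, inner ℂ (T x) y = inner ℂ x (T y))
    (hcomm : ∀ g z, T (η.tensor π g z) = η.tensor π g (T z)) :
    ∃ c : ℂ, ∀ z z', inner ℂ (T (embed H j z)) (embed H j z') =
      c * inner ℂ (embed H j z) (embed H j z') := by
  obtain ⟨A, hA⟩ := (embed H j).exists_inner_compression T
  have hAs : IsSelfAdjoint A := by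
    refine ContinuousLinearMap.isSelfAdjoint_iff_isSymmetric.2 fun z z' => ?_
    have h1 : inner ℂ (A z) z' = inner ℂ z (A z') := by
      rw [hA, hT, ← inner_conj_symm z, hA, inner_conj_symm]
    exact h1
  obtain ⟨c, hc⟩ := hσ.exists_eq_smul_one hAs fun g z =>
    ContinuousLinearMap.comm_of_inner_invariant (η.tensor σ g) (fun z z' => by
      rw [hA, hA, embed_tensor j hj, embed_tensor j hj, hcomm,
        LinearIsometryEquiv.inner_map_map]) z
  -- The inner product is conjugate-linear in its first argument.
  refine ⟨(starRingEnd ℂ) c, fun z z' => ?_⟩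
  rw [← hA, hc, inner_embed]
  exact inner_smul_left _ _ _

/-- An interior point would have nearby a tuple with an irreducible block containing `y`, `y'` and
`y₀`. There `T` acts as a scalar in the sense of forms, and the two products in the margin cancel.
-/
theorem interior_nonscalarCommutant [Finite S] [Nontrivial S] [CompleteSpace M]
    (η : UnitaryRep (FreeGroup S) H)
    (hirr : ∀ (F : Type) [NormedAddCommGroup F] [InnerProductSpace ℂ F] [FiniteDimensional ℂ F]
      (π : UnitaryRep (FreeGroup S) F), π.IsIrreducible → (η.tensor π).IsIrreducible)
    (x x' x₀ : H) (y y' y₀ : M) (hy₀ : y₀ ≠ 0) {δ : ℝ} (hδ : 0 < δ) :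
    interior (nonscalarCommutant η ((x ⊗ₜ[ℂ] y : H ⊗[ℂ] M) : HilbertTensor H M)
      ((x' ⊗ₜ[ℂ] y' : H ⊗[ℂ] M) : HilbertTensor H M)
      ((x₀ ⊗ₜ[ℂ] y₀ : H ⊗[ℂ] M) : HilbertTensor H M) δ) = ∅ := by
  classical
  refine Set.eq_empty_iff_forall_notMem.2 fun a ha => ?_
  obtain ⟨b, hb, d, j, σ, hσ, hY, hj⟩ := exists_mem_nhds_irreducible_subrepresentation
    (mem_interior_iff_mem_nhds.1 ha) {y₀, y, y'} (Finset.mem_insert_self _ _) hy₀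
  obtain ⟨T, _, hT, hinv, hle⟩ := hb
  obtain ⟨v₀, rfl⟩ := hY y₀ (by simp)
  obtain ⟨v, rfl⟩ := hY y (by simp)
  obtain ⟨v', rfl⟩ := hY y' (by simp)
  have hcomm := UnitaryRep.comm_of_comm_of (ρ := η.tensor (UnitaryRep.ofTuple b)) (T := T)
    fun s z => ContinuousLinearMap.comm_of_inner_invariant _ (fun z z' => by
      rw [UnitaryRep.tensor_ofTuple_of, UnitaryRep.tensor_ofTuple_of]; exact hinv s z z') z
  obtain ⟨c, hform⟩ := HilbertTensor.exists_inner_embed_eq (hirr _ σ hσ) hj hT hcomm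
  rw [← HilbertTensor.embed_tmul, ← HilbertTensor.embed_tmul, ← HilbertTensor.embed_tmul, hform,
    hform] at hle
  have h0 : ∀ p q r : ℂ, p * q * r - p * r * q = 0 := fun p q r => by ring
  rw [h0, norm_zero] at hle
  linarith

/-- If no margin were positive, the scalar identity would extend by continuity from the dense
sequences to all elementary tensors, making the projection `T` a multiple of `1`. -/
theorem exists_mem_nonscalarCommutant [TopologicalSpace.SeparableSpace H]
    [TopologicalSpace.SeparableSpace M] (η : UnitaryRep (FreeGroup S) H) {x₀ : H} {y₀ : M}
    (hx₀ : x₀ ≠ 0) (hy₀ : y₀ ≠ 0) {a : S → StrongUnitary M}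
    (ha : ¬ (η.tensor (UnitaryRep.ofTuple a)).IsIrreducible) :
    ∃ i i' k k' n : ℕ, a ∈ nonscalarCommutant η
      ((TopologicalSpace.denseSeq H i ⊗ₜ[ℂ] TopologicalSpace.denseSeq M k : H ⊗[ℂ] M) :
        HilbertTensor H M)
      ((TopologicalSpace.denseSeq H i' ⊗ₜ[ℂ] TopologicalSpace.denseSeq M k' : H ⊗[ℂ] M) :
        HilbertTensor H M)
      ((x₀ ⊗ₜ[ℂ] y₀ : H ⊗[ℂ] M) : HilbertTensor H M) (1 / ((n : ℝ) + 1)) := by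
  set ω := ((x₀ ⊗ₜ[ℂ] y₀ : H ⊗[ℂ] M) : HilbertTensor H M)
  have hω : ω ≠ 0 := by
    rw [← norm_ne_zero_iff, HilbertTensor.norm_coe_tmul]
    exact mul_ne_zero (norm_ne_zero_iff.2 hx₀) (norm_ne_zero_iff.2 hy₀)
  have : Nontrivial (HilbertTensor H M) := ⟨ω, 0, hω⟩
  obtain ⟨T, hT1, hTs, hcomm, hne⟩ := UnitaryRep.exists_commuting_projection ha
  by_contra! hcon
  have hzero : ∀ i i' k k', inner ℂ
      (T ((TopologicalSpace.denseSeq H i ⊗ₜ[ℂ] TopologicalSpace.denseSeq M k : H ⊗[ℂ] M) :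
        HilbertTensor H M))
      ((TopologicalSpace.denseSeq H i' ⊗ₜ[ℂ] TopologicalSpace.denseSeq M k' : H ⊗[ℂ] M) :
        HilbertTensor H M) * inner ℂ ω ω = inner ℂ (T ω) ω * inner ℂ
      ((TopologicalSpace.denseSeq H i ⊗ₜ[ℂ] TopologicalSpace.denseSeq M k : H ⊗[ℂ] M) :
        HilbertTensor H M)
      ((TopologicalSpace.denseSeq H i' ⊗ₜ[ℂ] TopologicalSpace.denseSeq M k' : H ⊗[ℂ] M) :
        HilbertTensor H M) := by
    intro i i' k k'
    by_contra h
    obtain ⟨n, hn⟩ := exists_nat_one_div_lt (norm_pos_iff.2 (sub_ne_zero.2 h))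
    refine hcon i i' k k' n ⟨T, hT1, ?_, fun s x y => ?_, hn.le⟩
    · exact (ContinuousLinearMap.isSelfAdjoint_iff_isSymmetric.1 hTs)
    · rw [← UnitaryRep.tensor_ofTuple_of, ← UnitaryRep.tensor_ofTuple_of, hcomm,
        LinearIsometryEquiv.inner_map_map]
  have hdense := ((TopologicalSpace.denseRange_denseSeq H).prodMap
    (TopologicalSpace.denseRange_denseSeq M)).prodMap
    ((TopologicalSpace.denseRange_denseSeq H).prodMap (TopologicalSpace.denseRange_denseSeq M))
  have hc1 : Continuous fun p : (H × M) × (H × M) =>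
      ((p.1.1 ⊗ₜ[ℂ] p.1.2 : H ⊗[ℂ] M) : HilbertTensor H M) :=
    HilbertTensor.continuous_coe_tmul.comp continuous_fst
  have hc2 : Continuous fun p : (H × M) × (H × M) =>
      ((p.2.1 ⊗ₜ[ℂ] p.2.2 : H ⊗[ℂ] M) : HilbertTensor H M) :=
    HilbertTensor.continuous_coe_tmul.comp continuous_snd
  have heq := hdense.equalizer
    (g := fun p : (H × M) × (H × M) => inner ℂ
      (T ((p.1.1 ⊗ₜ[ℂ] p.1.2 : H ⊗[ℂ] M) : HilbertTensor H M))
      ((p.2.1 ⊗ₜ[ℂ] p.2.2 : H ⊗[ℂ] M) : HilbertTensor H M) * inner ℂ ω ω)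
    (h := fun p : (H × M) × (H × M) => inner ℂ (T ω) ω * inner ℂ
      ((p.1.1 ⊗ₜ[ℂ] p.1.2 : H ⊗[ℂ] M) : HilbertTensor H M)
      ((p.2.1 ⊗ₜ[ℂ] p.2.2 : H ⊗[ℂ] M) : HilbertTensor H M))
    (((T.continuous.comp hc1).inner hc2).mul continuous_const)
    (continuous_const.mul (hc1.inner hc2))
    (funext fun p => hzero p.1.1 p.2.1 p.1.2 p.2.2)
  have hω' : inner ℂ ω ω ≠ 0 := inner_self_ne_zero.2 hω
  set c := (starRingEnd ℂ) (inner ℂ (T ω) ω / inner ℂ ω ω) with hc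
  refine hne c (sub_eq_zero.1 (HilbertTensor.eq_zero_of_inner_tmul fun x y x' y' => ?_))
  have := congrFun heq ((x, y), (x', y'))
  simp only at this
  rw [sub_apply, inner_sub_left, sub_eq_zero]
  change _ = inner ℂ (c • ((x ⊗ₜ[ℂ] y : H ⊗[ℂ] M) : HilbertTensor H M)) _
  rw [inner_smul_left, hc, Complex.conj_conj, div_mul_eq_mul_div, eq_div_iff hω']
  exact this

/-- The trivial representation is the test case through which `H` itself is seen to be nonzero and
separable. -/
theorem UnitaryRep.isIrreducible_one_complex {G : Type*} [Group G] :
    (1 : UnitaryRep G ℂ).IsIrreducible :=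
  ⟨inferInstance, fun K _ _ => eq_bot_or_eq_top K⟩

theorem HilbertTensor.nontrivial_left [Nontrivial (HilbertTensor H M)] : Nontrivial H := by
  by_contra h
  rw [not_nontrivial_iff_subsingleton] at h
  obtain ⟨z, hz⟩ := exists_ne (0 : HilbertTensor H M)
  have : ContinuousLinearMap.id ℂ (HilbertTensor H M) = 0 := HilbertTensor.clm_ext fun x y => by
    rw [Subsingleton.elim x 0, TensorProduct.zero_tmul, UniformSpace.Completion.coe_zero, map_zero,
      map_zero]
  exact hz (congrArg (fun A : HilbertTensor H M →L[ℂ] HilbertTensor H M => A z) this)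

theorem HilbertTensor.separableSpace_left [TopologicalSpace.SeparableSpace (HilbertTensor H ℂ)] :
    TopologicalSpace.SeparableSpace H := by
  have hiso : Isometry fun x : H => ((x ⊗ₜ[ℂ] (1 : ℂ) : H ⊗[ℂ] ℂ) : HilbertTensor H ℂ) := by
    refine Isometry.of_dist_eq fun x y => ?_
    rw [UniformSpace.Completion.dist_eq, dist_eq_norm, dist_eq_norm, ← TensorProduct.sub_tmul,
      TensorProduct.norm_tmul, norm_one, mul_one]
  have := UniformSpace.secondCountable_of_separable (HilbertTensor H ℂ)
  have := hiso.isEmbedding.secondCountableTopology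
  infer_instance

end Generic

theorem theorem1 {S : Type u} [Finite S] [Nontrivial S]
    {H : Type v} [NormedAddCommGroup H] [InnerProductSpace ℂ H] [CompleteSpace H]
    (η : UnitaryRep (FreeGroup S) H) (hη : η.IsTempered)
    (hirr : ∀ (F : Type) [NormedAddCommGroup F] [InnerProductSpace ℂ F] [FiniteDimensional ℂ F]
      (π : UnitaryRep (FreeGroup S) F), π.IsIrreducible → (η.tensor π).IsIrreducible)
    (M : Type w) [NormedAddCommGroup M] [InnerProductSpace ℂ M] [CompleteSpace M]
    [TopologicalSpace.SeparableSpace M] (hM : ¬ FiniteDimensional ℂ M) :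
    {a : S → StrongUnitary M | (η.tensor (UnitaryRep.ofTuple a)).IsIrreducible} ∈
        residual (S → StrongUnitary M) ∧
      ¬ IsMeagre {a : S → StrongUnitary M |
        (η.tensor (UnitaryRep.ofTuple a)).IsIrreducible} := by
  have h1 := hirr ℂ 1 UnitaryRep.isIrreducible_one_complex
  have : Countable (FreeGroup S) := inferInstance
  have := h1.separableSpace
  have : TopologicalSpace.SeparableSpace H := HilbertTensor.separableSpace_left
  have := h1.1
  have : Nontrivial H := HilbertTensor.nontrivial_left (M := ℂ)
  have : Nontrivial M := by
    by_contra h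
    rw [not_nontrivial_iff_subsingleton] at h
    exact hM inferInstance
  obtain ⟨x₀, hx₀⟩ := exists_ne (0 : H)
  obtain ⟨y₀, hy₀⟩ := exists_ne (0 : M)
  have hres : {a : S → StrongUnitary M | (η.tensor (UnitaryRep.ofTuple a)).IsIrreducible} ∈
      residual (S → StrongUnitary M) := by
    have hmem : ∀ p : ℕ × ℕ × ℕ × ℕ × ℕ, (nonscalarCommutant η
      ((TopologicalSpace.denseSeq H p.1 ⊗ₜ[ℂ] TopologicalSpace.denseSeq M p.2.2.1 : H ⊗[ℂ] M) :
        HilbertTensor H M)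
      ((TopologicalSpace.denseSeq H p.2.1 ⊗ₜ[ℂ] TopologicalSpace.denseSeq M p.2.2.2.1 :
        H ⊗[ℂ] M) : HilbertTensor H M)
      ((x₀ ⊗ₜ[ℂ] y₀ : H ⊗[ℂ] M) : HilbertTensor H M) (1 / ((p.2.2.2.2 : ℝ) + 1)))ᶜ ∈
        residual (S → StrongUnitary M) := fun p =>
      residual_of_dense_open (isClosed_nonscalarCommutant ..).isOpen_compl
        (interior_eq_empty_iff_dense_compl.1
          (interior_nonscalarCommutant η hirr _ _ _ _ _ _ hy₀ Nat.one_div_pos_of_nat))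
    refine mem_of_superset (countable_iInter_mem.2 hmem) fun a ha => ?_
    by_contra hcon
    obtain ⟨i, i', k, k', n, h⟩ := exists_mem_nonscalarCommutant η hx₀ hy₀ hcon
    exact Set.mem_iInter.1 ha (i, i', k, k', n) h
  -- A finite product of Polish spaces is Baire; once nonempty, its comeagre sets are not meagre.
  have : Nonempty (S → StrongUnitary M) := ⟨fun _ => (1 : M ≃ₗᵢ[ℂ] M)⟩
  exact ⟨hres, not_isMeagre_of_mem_residual hres⟩
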